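/- For a finite group $G$, let $P(G)=|\{(g,h)\in G\times G: gh=hg\}|/|G|^2$ be its commuting probability. Let $S=\{P(G): G \text{ a finite group}\}\subseteq(0,1]$ and $X=S\cup\{0\}\subseteq\mathbb{R}$. Then $X$ is closed. For a closed set $Y\subseteq\mathbb{R}$, let $Y'$ be its set of limit points, and for ordinals $\alpha$ define the iterated derived sets by $X^0=X$, $X^{\alpha+1}=(X^\alpha)'$, and $X^\alpha=\bigcap_{\beta<\alpha}X^\beta$ if $\alpha$ is a limit ordinal. Write $\frac1kX=\{x/k: x\in X\}$ and, for an integer $k\ge1$, let $\Omega(k)$ be the number of prime factors of $k$ counted with multiplicity. Then: 1. $X'=\bigcup_{k\ge2}\frac1kX=\bigcup_{p\text{ prime}}\frac1pX$. 2. For every integer $n\ge0$, $X^n=\bigcup_{k\ge1,\ \Omega(k)\ge n}\frac1kX=\bigcup_{k\ge1,\ \Omega(k)=n}\frac1kX$. 3. $X^\omega=\{0\}$. 4. $S$ is well-ordered by the reverse of the usual order of $\mathbb{R}$, and its order type with respect to this reverse ordering is $\omega^\omega$ (ordinal exponentiation). -/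

import Mathlib

open scoped Pointwise Ordinal

/-- The set of all commuting probabilities of finite groups. (Every finite group is isomorphic to
one whose underlying type lives in the lowest universe.) -/
def commProbSet : Set ℝ :=
  {x | ∃ (G : Type) (_ : Group G) (_ : Finite G), x = (commProb G : ℝ)}

/-! The engine is `exists_limit_commProb`: along an ultrafilter, commuting probabilities bounded
away from `0` converge to some `q / k` with `q ∈ S` and `k ≥ 1`, are eventually at least this limit,
and are eventually equal to `q` when `k = 1`.

To prove it, let `F` be the subgroup generated by the elements with small conjugacy class. It has
bounded index, and since words of bounded length exhaust it, its classes are bounded; by Neumann's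
theorem its commutator subgroup is bounded. If the cutoff is chosen where the index stabilises at
`i`, pairs not inside `F` rarely commute, so `P(G)` is close to `P(F) / i ^ 2`. For `H` with bounded
commutator subgroup, a normal subgroup `L ≤ H'` of stable order `l` is found which is covered by the
commutators of almost every element, so `P(H)` is close to `P(H ⧸ L) / l`, while the center of `H ⧸
L` has bounded index, so that `P(H ⧸ L)` takes finitely many values. Hence `k = i ^ 2 * l`.

Approach from above only rules out increasing sequences, so `S` is reverse well-ordered, and a limit
point has `k ≥ 2` or is `0`. Conversely, `S` is closed under products and contains every `1 / k`,
and Heisenberg groups make `1 / p` a limit point. This gives `derivedSet_commProbLayer`, from which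
closedness and all the derived sets follow.

For the order type, positions are counted downward from `1`. Points at nonzero multiples of `ω ^ n`
lie in the `n`-th derived set, and non-maximal points of that set have position at least `ω ^ n`. As
`0` is the only point in all of these sets, its position is `ω ^ ω`, and `S` is what precedes it. -/

/-! ### Counting commuting pairs -/

section CommutingPairs

variable {G : Type*} [Group G] [Finite G]

omit [Finite G] in
theorem ncard_commute_pairs :
    {p : G × G | Commute p.1 p.2}.ncard = Nat.card {p : G × G // Commute p.1 p.2} := rfl

theorem ncard_prod_fiber_le {α β : Type*} [Finite α] [Finite β] (A : Set α) (s : Set (α × β))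
    (m : ℕ) (hs : ∀ p ∈ s, p.1 ∈ A) (h : ∀ a ∈ A, {b | (a, b) ∈ s}.ncard ≤ m) :
    s.ncard ≤ m * A.ncard := by
  classical
  have := Fintype.ofFinite α
  have := Fintype.ofFinite β
  rw [Set.ncard_eq_toFinset_card', Set.ncard_eq_toFinset_card']
  refine Finset.card_le_mul_card_image_of_maps_to (f := Prod.fst) (fun p hp => ?_) m
    (fun a ha => ?_)
  · simpa using hs p (by simpa using hp)
  · refine le_trans ?_ (h a (by simpa using ha))
    rw [Set.ncard_eq_toFinset_card']
    refine Finset.card_le_card_of_injOn Prod.snd ?_ ?_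
    · rintro ⟨x, y⟩ hp
      simp only [Finset.coe_filter, Set.mem_toFinset, Set.mem_ofPred_eq] at hp
      obtain ⟨hp, rfl⟩ := hp
      simpa using hp
    · rintro ⟨x, y⟩ hp ⟨x', y'⟩ hp' hyy
      simp only [Finset.coe_filter, Set.mem_toFinset, Set.mem_ofPred_eq] at hp hp'
      obtain ⟨_, rfl⟩ := hp
      obtain ⟨_, rfl⟩ := hp'
      simpa using hyy

omit [Finite G] in
theorem ncard_commuting_eq_card_centralizer (g : G) :
    {h : G | Commute g h}.ncard = Nat.card (Subgroup.centralizer {g}) := by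
  rw [← Nat.card_coe_set_eq]
  congr
  ext h
  exact Commute.symm_iff.trans Subgroup.mem_centralizer_singleton_iff.symm

/-- Few commuting pairs have a first entry with a large conjugacy class. -/
theorem ncard_commute_pairs_notMem_le (A : Set G) (r : ℕ)
    (hA : ∀ g ∉ A, r ≤ (Subgroup.centralizer {g}).index) :
    r * {p : G × G | Commute p.1 p.2 ∧ p.1 ∉ A}.ncard ≤ Nat.card G ^ 2 := by
  rcases Nat.eq_zero_or_pos r with rfl | hr
  · simp
  have h := ncard_prod_fiber_le Aᶜ {p : G × G | Commute p.1 p.2 ∧ p.1 ∉ A} (Nat.card G / r)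
    (fun p hp => hp.2) (fun g hg => ?_)
  · calc _ ≤ r * (Nat.card G / r * Aᶜ.ncard) := Nat.mul_le_mul_left _ h
      _ = (r * (Nat.card G / r)) * Aᶜ.ncard := by ring
      _ ≤ Nat.card G * Nat.card G := Nat.mul_le_mul (Nat.mul_div_le _ _) (Set.ncard_le_card _)
      _ = _ := (sq _).symm
  · refine (Set.ncard_le_ncard (t := {h : G | Commute g h}) (fun h hh => hh.1)).trans ?_
    rw [ncard_commuting_eq_card_centralizer, Nat.le_div_iff_mul_le hr,
      ← (Subgroup.centralizer {g}).card_mul_index]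
    exact Nat.mul_le_mul_left _ (hA g hg)

omit [Finite G] in
theorem commProb_eq_ncard_div :
    (commProb G : ℝ) = {p : G × G | Commute p.1 p.2}.ncard / (Nat.card G : ℝ) ^ 2 := by
  rw [commProb_def, ncard_commute_pairs]
  push_cast
  rfl

/-- If `G` has large commuting probability then a positive proportion of its elements have small
conjugacy class. -/
theorem card_le_mul_ncard_of_le_commProb {a r : ℕ} (ha : 0 < a) (har : a ≤ r)
    (h : (2 / a : ℝ) ≤ commProb G) :
    Nat.card G ≤ a * {g : G | (Subgroup.centralizer {g}).index ≤ r}.ncard := by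
  set A := {g : G | (Subgroup.centralizer {g}).index ≤ r}
  have h1 := ncard_commute_pairs_notMem_le A a
    (fun g hg => har.trans (not_le.1 hg).le)
  have h2 : {p : G × G | Commute p.1 p.2}.ncard ≤ A.ncard * Nat.card G +
      {p : G × G | Commute p.1 p.2 ∧ p.1 ∉ A}.ncard := by
    have : {p : G × G | Commute p.1 p.2} ⊆
        A ×ˢ Set.univ ∪ {p : G × G | Commute p.1 p.2 ∧ p.1 ∉ A} := by
      intro p hp
      by_cases hA : p.1 ∈ A
      · exact Or.inl ⟨hA, trivial⟩
      · exact Or.inr ⟨hp, hA⟩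
    refine (Set.ncard_le_ncard this).trans ((Set.ncard_union_le _ _).trans ?_)
    rw [Set.ncard_prod, Set.ncard_univ]
  have hG : (0 : ℝ) < Nat.card G := Nat.cast_pos.2 Nat.card_pos
  have ha' : (0 : ℝ) < a := Nat.cast_pos.2 ha
  rw [commProb_eq_ncard_div, div_le_div_iff₀ ha' (by positivity)] at h
  have h3 : 2 * Nat.card G ^ 2 ≤ {p : G × G | Commute p.1 p.2}.ncard * a := by exact_mod_cast h
  -- Of the density `2 / a`, at most `1 / a` comes from pairs starting outside `A`; the rest must be
  -- supplied by `A`.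
  have h4 : Nat.card G * Nat.card G ≤ (a * A.ncard) * Nat.card G := by nlinarith
  exact Nat.le_of_mul_le_mul_right h4 Nat.card_pos

/-- A commuting pair lies in `F × F` or has an entry outside `F`; by symmetry the latter pairs have
density at most twice `1 / r`. -/
theorem Subgroup.commProb_le_of_notMem (F : Subgroup G) {r : ℕ} (hr : 0 < r)
    (hF : ∀ g ∉ F, r ≤ (Subgroup.centralizer {g}).index) :
    (commProb G : ℝ) ≤ commProb F / (F.index : ℝ) ^ 2 + 2 / r := by
  have h1 := ncard_commute_pairs_notMem_le (F : Set G) r hF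
  have h2 : {p : G × G | Commute p.1 p.2}.ncard ≤ {p : F × F | Commute p.1 p.2}.ncard +
      2 * {p : G × G | Commute p.1 p.2 ∧ p.1 ∉ (F : Set G)}.ncard := by
    have : {p : G × G | Commute p.1 p.2} ⊆
        Prod.map ((↑) : F → G) ((↑) : F → G) '' {p : F × F | Commute p.1 p.2} ∪
        ({p : G × G | Commute p.1 p.2 ∧ p.1 ∉ (F : Set G)} ∪
        Prod.swap '' {p : G × G | Commute p.1 p.2 ∧ p.1 ∉ (F : Set G)}) := by
      rintro ⟨g, h⟩ (hp : Commute g h)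
      by_cases hg : g ∈ F
      · by_cases hh : h ∈ F
        · exact Or.inl ⟨(⟨g, hg⟩, ⟨h, hh⟩), Subtype.ext hp, rfl⟩
        · exact Or.inr (Or.inr ⟨(h, g), ⟨hp.symm, hh⟩, rfl⟩)
      · exact Or.inr (Or.inl ⟨hp, hg⟩)
    refine (Set.ncard_le_ncard this).trans ((Set.ncard_union_le _ _).trans ?_)
    refine add_le_add (Set.ncard_image_le) ((Set.ncard_union_le _ _).trans ?_)
    rw [two_mul]
    exact add_le_add le_rfl Set.ncard_image_le
  have hG : (0 : ℝ) < Nat.card G := Nat.cast_pos.2 Nat.card_pos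
  have hF0 : (0 : ℝ) < Nat.card F := Nat.cast_pos.2 Nat.card_pos
  have hi : (0 : ℝ) < F.index := Nat.cast_pos.2 (Nat.pos_of_ne_zero F.index_ne_zero_of_finite)
  have hr' : (0 : ℝ) < r := Nat.cast_pos.2 hr
  have hGF : (Nat.card G : ℝ) = Nat.card F * F.index := by exact_mod_cast F.card_mul_index.symm
  rw [commProb_eq_ncard_div, commProb_eq_ncard_div, div_div, ← mul_pow, ← hGF,
    div_add_div _ _ (by positivity) (by positivity),
    div_le_div_iff₀ (by positivity) (by positivity)]
  have h1' : (r * {p : G × G | Commute p.1 p.2 ∧ p.1 ∉ (F : Set G)}.ncard : ℝ)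
    ≤ (Nat.card G : ℝ) ^ 2 := by exact_mod_cast h1
  have h2' : ({p : G × G | Commute p.1 p.2}.ncard : ℝ) ≤ {p : F × F | Commute p.1 p.2}.ncard +
      2 * {p : G × G | Commute p.1 p.2 ∧ p.1 ∉ (F : Set G)}.ncard := by exact_mod_cast h2
  have h3 := mul_le_mul_of_nonneg_right h2' hr'.le
  have : ({p : G × G | Commute p.1 p.2}.ncard : ℝ) * r ≤
      {p : F × F | Commute p.1 p.2}.ncard * r + (Nat.card G : ℝ) ^ 2 * 2 := by linarith
  calc _ = (({p : G × G | Commute p.1 p.2}.ncard : ℝ) * r) * (Nat.card G : ℝ) ^ 2 := by ring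
    _ ≤ _ := mul_le_mul_of_nonneg_right this (by positivity)

end CommutingPairs

/-! ### Growth of powers of a dense symmetric set -/

section Growth

variable {G : Type*} [Group G] [Finite G]

omit [Finite G] in
theorem closure_subset_pow_of_succ_subset {X : Set G} (h1 : 1 ∈ X) (hinv : X⁻¹ = X) {i : ℕ}
    (h : X ^ (i + 1) ⊆ X ^ i) : (Subgroup.closure X : Set G) ⊆ X ^ i := by
  intro g hg
  induction hg using Subgroup.closure_induction_right with
  | one => exact Set.one_mem_pow h1
  | mul_right x _ y hy ih => exact h (by rw [pow_succ]; exact Set.mul_mem_mul ih hy)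
  | mul_inv_cancel x _ y hy ih =>
    refine h ?_
    rw [pow_succ]
    exact Set.mul_mem_mul ih (by rw [← hinv]; simpa using hy)

/-- If `g ∈ X ^ (3 * j + 3)` is not in `X ^ (3 * j + 2)`, then `g • X` is disjoint from `X ^ (3 * j
+ 1)`. So every three steps either the powers have stopped growing or `X.ncard` new elements appear.
-/
theorem closure_subset_pow_or_card_le {X : Set G} (h1 : 1 ∈ X) (hinv : X⁻¹ = X) (j : ℕ) :
    (Subgroup.closure X : Set G) ⊆ X ^ (3 * j) ∨ (j + 1) * X.ncard ≤ (X ^ (3 * j + 1)).ncard := by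
  induction j with
  | zero => right; simp
  | succ j ih =>
    by_cases hs : X ^ (3 * j + 3) ⊆ X ^ (3 * j + 2)
    · left
      refine (closure_subset_pow_of_succ_subset h1 hinv hs).trans ?_
      exact Set.pow_subset_pow_right h1 (by omega)
    rcases ih with ih | ih
    · left
      exact ih.trans (Set.pow_subset_pow_right h1 (by omega))
    right
    obtain ⟨g, hg, hg'⟩ := Set.not_subset.1 hs
    have hd : Disjoint (X ^ (3 * j + 1)) (g • X) := by
      rw [Set.disjoint_left]
      rintro _ hx ⟨y, hy, rfl⟩
      apply hg'
      rw [pow_succ]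
      refine ⟨_, hx, y⁻¹, by rw [← hinv]; simpa using hy, by simp⟩
    have hsub : X ^ (3 * j + 1) ∪ g • X ⊆ X ^ (3 * (j + 1) + 1) := by
      refine Set.union_subset (Set.pow_subset_pow_right h1 (by omega)) ?_
      rintro _ ⟨y, hy, rfl⟩
      rw [show 3 * (j + 1) + 1 = (3 * j + 3) + 1 by ring, pow_succ]
      exact Set.mul_mem_mul hg hy
    calc (j + 1 + 1) * X.ncard = (j + 1) * X.ncard + X.ncard := by ring
      _ ≤ (X ^ (3 * j + 1)).ncard + (g • X).ncard := by
        refine add_le_add ih ?_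
        rw [Set.ncard_smul_set]
      _ = _ := (Set.ncard_union_eq hd).symm
      _ ≤ _ := Set.ncard_le_ncard hsub

/-- The subgroup generated by a symmetric set of density at least `1 / a` is exhausted by words of
length `3 * a`. -/
theorem closure_subset_pow_of_card_le {X : Set G} (h1 : 1 ∈ X) (hinv : X⁻¹ = X) {a : ℕ}
    (ha : Nat.card G ≤ a * X.ncard) : (Subgroup.closure X : Set G) ⊆ X ^ (3 * a) := by
  refine (closure_subset_pow_or_card_le h1 hinv a).resolve_right fun h => ?_
  have h2 : (X ^ (3 * a + 1)).ncard ≤ Nat.card G := Set.ncard_le_card _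
  have h3 : 0 < X.ncard := (Set.ncard_pos).2 ⟨1, h1⟩
  nlinarith

omit [Finite G] in
variable (G) in
theorem index_centralizer_one : (Subgroup.centralizer {(1 : G)}).index = 1 := by
  rw [Subgroup.index_eq_one, eq_top_iff]
  intro x _
  simp [Subgroup.mem_centralizer_singleton_iff]

theorem index_centralizer_mul_le (g h : G) :
    (Subgroup.centralizer {g * h}).index ≤
      (Subgroup.centralizer {g}).index * (Subgroup.centralizer {h}).index := by
  refine le_trans ?_ (Subgroup.index_inf_le (H := Subgroup.centralizer {g}) (K := Subgroup.centralizer {h}))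
  refine Subgroup.index_antitone fun x hx => ?_
  rw [Subgroup.mem_inf, Subgroup.mem_centralizer_singleton_iff,
    Subgroup.mem_centralizer_singleton_iff] at hx
  rw [Subgroup.mem_centralizer_singleton_iff]
  exact ((show Commute x g from hx.1).mul_right hx.2)

theorem index_centralizer_le_pow {r : ℕ} (n : ℕ) {g : G}
    (hg : g ∈ {g : G | (Subgroup.centralizer {g}).index ≤ r} ^ n) :
    (Subgroup.centralizer {g}).index ≤ r ^ n := by
  induction n generalizing g with
  | zero =>
    simp only [pow_zero, Set.mem_one] at hg
    subst hg
    simp [index_centralizer_one]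
  | succ n ih =>
    rw [pow_succ] at hg
    obtain ⟨x, hx, y, hy, rfl⟩ := hg
    rw [pow_succ]
    exact (index_centralizer_mul_le x y).trans (Nat.mul_le_mul (ih hx) hy)

variable (G) in
/-- The subgroup generated by the elements with at most `r` conjugates. -/
def smallClassSubgroup (r : ℕ) : Subgroup G :=
  Subgroup.closure {g : G | (Subgroup.centralizer {g}).index ≤ r}

omit [Finite G] in
variable (G) in
theorem smallClassSubgroup_mono : Monotone (smallClassSubgroup G) := fun _ _ h =>
  Subgroup.closure_mono fun _ hg => le_trans hg h

omit [Finite G] in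
theorem lt_index_centralizer_of_notMem_smallClassSubgroup {r : ℕ} {g : G}
    (hg : g ∉ smallClassSubgroup G r) : r < (Subgroup.centralizer {g}).index :=
  not_le.1 fun h => hg (Subgroup.subset_closure h)

/-- The generators have density at least `1 / a`, so words of length `3 * a` suffice, and each
letter multiplies the class size by at most `r`. -/
theorem index_centralizer_le_of_mem_smallClassSubgroup {a r : ℕ} (ha : 0 < a) (har : a ≤ r)
    (h : (2 / a : ℝ) ≤ commProb G) {g : G} (hg : g ∈ smallClassSubgroup G r) :
    (Subgroup.centralizer {g}).index ≤ r ^ (3 * a) := by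
  refine index_centralizer_le_pow _ (closure_subset_pow_of_card_le ?_ ?_
    (card_le_mul_ncard_of_le_commProb ha har h) hg)
  · exact (index_centralizer_one G).trans_le (by omega)
  · ext g
    have : Subgroup.centralizer {g⁻¹} = Subgroup.centralizer {g} := by
      ext x
      simp only [Subgroup.mem_centralizer_singleton_iff]
      exact Commute.inv_right_iff
    simp [this]

theorem index_smallClassSubgroup_le {a r : ℕ} (ha : 0 < a) (har : a ≤ r)
    (h : (2 / a : ℝ) ≤ commProb G) : (smallClassSubgroup G r).index ≤ a := by
  have h1 := card_le_mul_ncard_of_le_commProb ha har h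
  have h2 : {g : G | (Subgroup.centralizer {g}).index ≤ r}.ncard ≤
      Nat.card (smallClassSubgroup G r) :=
    Set.ncard_le_ncard Subgroup.subset_closure
  rw [← (smallClassSubgroup G r).card_mul_index] at h1
  have h3 : 0 < Nat.card (smallClassSubgroup G r) := Nat.card_pos
  nlinarith

end Growth

/-! ### Neumann's theorem on bounded conjugacy classes -/

section BoundedClasses

open scoped commutatorElement

theorem ncard_range_conj {G : Type*} [Group G] (g : G) :
    (Set.range fun x : G => x * g * x⁻¹).ncard = (Subgroup.centralizer {g}).index := by
  have h := MulAction.index_stabilizer (ConjAct G) g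
  rw [ConjAct.stabilizer_eq_centralizer] at h
  exact h.symm

theorem Set.ncard_image2_le {α β γ : Type*} (f : α → β → γ) (s : Set α) (t : Set β)
    (hs : s.Finite) (ht : t.Finite) : (Set.image2 f s t).ncard ≤ s.ncard * t.ncard := by
  rw [← Set.ncard_prod, ← Set.image_uncurry_prod]
  exact Set.ncard_image_le (hs.prod ht)

variable {G : Type*} [Group G] [Finite G]

/-- If all conjugacy classes have at most `M` elements, then some subgroup of bounded index has few
commutators with the whole group. -/
theorem exists_subgroup_commutators_subset {M : ℕ}
    (h : ∀ g : G, (Subgroup.centralizer {g}).index ≤ M) :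
    ∃ (C : Subgroup G) (T : Set G), C.index ≤ M ^ M ∧ T.ncard ≤ M * M ∧
      ∀ u ∈ C, ∀ x : G, ⁅u, x⁆ ∈ T := by
  have hM : 1 ≤ M := (index_centralizer_one G).symm.trans_le (h 1)
  -- Take `a` with the largest class `S`. If `u` centralizes elements `b s` conjugating `a` to each
  -- `s ∈ S`, the class of `u⁻¹ * a` contains `u⁻¹ • S`, hence equals it by maximality. This places
  -- `⁅u, x⁆` in `S * S⁻¹`.
  obtain ⟨a, ha⟩ := Finite.exists_max fun g : G => (Subgroup.centralizer {g}).index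
  set S := Set.range fun x : G => x * a * x⁻¹ with hS
  have hSM : S.ncard ≤ M := (ncard_range_conj a).trans_le (h a)
  choose b hb using fun s : S => s.2
  have := Fintype.ofFinite S
  refine ⟨⨅ s : S, Subgroup.centralizer {b s}, S * S⁻¹, ?_, ?_, fun u hu x => ?_⟩
  · refine (Subgroup.index_iInf_le _).trans ((Finset.prod_le_pow_card _ _ M fun s _ => h _).trans ?_)
    rw [Finset.card_univ, ← Nat.card_eq_fintype_card, Nat.card_coe_set_eq]
    exact Nat.pow_le_pow_right hM hSM
  · have h1 : (S * S⁻¹).ncard ≤ S.ncard * S⁻¹.ncard := Set.natCard_mul_le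
    rw [Set.ncard_inv] at h1
    exact h1.trans (Nat.mul_le_mul hSM hSM)
  · have hu' : ∀ s : S, b s * u⁻¹ * (b s)⁻¹ = u⁻¹ := fun s => by
      have := (Subgroup.mem_iInf.1 ((⨅ s : S, Subgroup.centralizer {b s}).inv_mem hu)) s
      rw [Subgroup.mem_centralizer_singleton_iff] at this
      rw [← this, mul_inv_cancel_right]
    have h1 : u⁻¹ • S ⊆ Set.range fun x : G => x * (u⁻¹ * a) * x⁻¹ := by
      rintro _ ⟨s, hs, rfl⟩
      refine ⟨b ⟨s, hs⟩, ?_⟩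
      calc _ = (b ⟨s, hs⟩ * u⁻¹ * (b ⟨s, hs⟩)⁻¹) * (b ⟨s, hs⟩ * a * (b ⟨s, hs⟩)⁻¹) := by group
        _ = _ := by rw [hu', show b ⟨s, hs⟩ * a * (b ⟨s, hs⟩)⁻¹ = s from hb ⟨s, hs⟩]; rfl
    have h2 : u⁻¹ • S = Set.range fun x : G => x * (u⁻¹ * a) * x⁻¹ := by
      refine Set.eq_of_subset_of_ncard_le h1 ?_
      rw [Set.ncard_smul_set, hS, ncard_range_conj, ncard_range_conj]
      exact ha _
    obtain ⟨s, hs, hs'⟩ : x * (u⁻¹ * a) * x⁻¹ ∈ u⁻¹ • S := h2 ▸ ⟨x, rfl⟩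
    have hs'' : s = u * (x * (u⁻¹ * a) * x⁻¹) := by rw [← hs']; simp
    refine ⟨s, hs, (x * a * x⁻¹)⁻¹, Set.inv_mem_inv.2 ⟨x, rfl⟩, ?_⟩
    simp only [hs'', commutatorElement_def]
    group

/-- Write `g = t * u` with `t` a coset representative and `u ∈ C`. Then `⁅g, x⁆ = t * ⁅u, x⁆ * t⁻¹ *
⁅t, x⁆`, where `⁅u, x⁆ ∈ T` and `⁅t, x⁆` is `t` times a conjugate of `t⁻¹`. -/
theorem ncard_commutatorSet_le {M : ℕ} (h : ∀ g : G, (Subgroup.centralizer {g}).index ≤ M) :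
    (commutatorSet G).ncard ≤ M ^ M * (M * M * M) := by
  obtain ⟨C, T, hC, hT, hCT⟩ := exists_subgroup_commutators_subset h
  let D : G → Set G := fun t => Set.image2 (fun y z => t * y * t⁻¹ * (t * z)) T
    (Set.range fun x : G => x * t⁻¹ * x⁻¹)
  have hD : ∀ t, (D t).ncard ≤ M * M * M := fun t => by
    refine (Set.ncard_image2_le _ _ _ (Set.toFinite _) (Set.toFinite _)).trans
      (Nat.mul_le_mul hT ?_)
    rw [ncard_range_conj]
    exact h _
  have hsub : commutatorSet G ⊆ ⋃ q : G ⧸ C, D q.out := by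
    rintro _ ⟨g, x, rfl⟩
    refine Set.mem_iUnion.2 ⟨(g : G ⧸ C), ?_⟩
    set t := ((g : G ⧸ C)).out with ht
    have hu : t⁻¹ * g ∈ C := QuotientGroup.eq.1 (QuotientGroup.out_eq' _)
    refine ⟨_, hCT _ hu x, _, ⟨x, rfl⟩, ?_⟩
    simp only [commutatorElement_def]
    group
  have := Fintype.ofFinite (G ⧸ C)
  refine (Set.ncard_le_ncard hsub).trans ((Set.ncard_iUnion_le_of_fintype _).trans ?_)
  refine (Finset.sum_le_card_nsmul _ _ _ fun q _ => hD q.out).trans ?_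
  rw [smul_eq_mul, Finset.card_univ, ← Nat.card_eq_fintype_card]
  exact Nat.mul_le_mul_right _ hC

/-- B. H. Neumann: bounded conjugacy classes give a bounded commutator subgroup. -/
theorem exists_card_commutator_le (M : ℕ) : ∃ B : ℕ, ∀ (G : Type) [Group G] [Finite G],
    (∀ g : G, (Subgroup.centralizer {g}).index ≤ M) → Nat.card (commutator G) ≤ B := by
  refine ⟨(Finset.range (M ^ M * (M * M * M) + 1)).sup Subgroup.cardCommutatorBound,
    fun G _ _ h => (Subgroup.card_commutator_le_of_finite_commutatorSet G).trans ?_⟩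
  refine Finset.le_sup (f := Subgroup.cardCommutatorBound) (Finset.mem_range.2 ?_)
  exact Nat.lt_succ_of_le (ncard_commutatorSet_le h)

theorem Subgroup.index_centralizer_subtype_le {G : Type*} [Group G] [Finite G] (F : Subgroup G)
    (g : F) : (Subgroup.centralizer {g}).index ≤ (Subgroup.centralizer {(g : G)}).index := by
  have : Subgroup.centralizer {g} = (Subgroup.centralizer {(g : G)}).subgroupOf F := by
    ext x
    simp [Subgroup.mem_subgroupOf, Subgroup.mem_centralizer_singleton_iff, Subtype.ext_iff]
  rw [this]
  rw [← Subgroup.relIndex_top_right (Subgroup.centralizer {(g : G)})]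
  exact Subgroup.relIndex_le_of_le_right le_top (by
    rw [Subgroup.relIndex_top_right]; exact Subgroup.index_ne_zero_of_finite)

end BoundedClasses

/-! ### Groups with bounded commutator subgroup -/

section CommutatorCentralizer

open scoped commutatorElement

variable {H : Type*} [Group H]

variable (H) in
/-- The centralizer of the commutator subgroup. -/
abbrev commutatorCentralizer : Subgroup H := Subgroup.centralizer (commutator H : Set H)

theorem commutatorElement_mem_commutator (g h : H) : ⁅g, h⁆ ∈ commutator H :=
  Subgroup.commutator_mem_commutator trivial trivial

theorem conj_commutatorElement_of_mem {u : H} (hu : u ∈ commutatorCentralizer H) (g h : H) :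
    u * ⁅g, h⁆ * u⁻¹ = ⁅g, h⁆ := by
  rw [← Subgroup.mem_centralizer_iff.1 hu _ (commutatorElement_mem_commutator g h),
    mul_inv_cancel_right]

theorem commutatorElement_mul_right_of_mem {m : H} (hm : m ∈ commutatorCentralizer H) (v n : H) :
    ⁅v, m * n⁆ = ⁅v, m⁆ * ⁅v, n⁆ := by
  rw [← conj_commutatorElement_of_mem hm v n]
  simp only [commutatorElement_def]
  group

theorem commutatorElement_mul_left_of_mem {u : H} (hu : u ∈ commutatorCentralizer H) (v n : H) :
    ⁅u * v, n⁆ = ⁅v, n⁆ * ⁅u, n⁆ := by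
  rw [← conj_commutatorElement_of_mem hu v n]
  simp only [commutatorElement_def]
  group

/-- The commutator with `v`, as a homomorphism on the centralizer of the commutator subgroup. -/
def commutatorHom (v : H) : commutatorCentralizer H →* H where
  toFun n := ⁅v, (n : H)⁆
  map_one' := by simp
  map_mul' m n := commutatorElement_mul_right_of_mem m.2 v n

/-- The elements of the centralizer of the commutator subgroup which are central in it modulo
`C`. -/
def centerModulo (C : Subgroup H) : Subgroup H where
  carrier := {v | v ∈ commutatorCentralizer H ∧ ∀ n ∈ commutatorCentralizer H, ⁅v, n⁆ ∈ C}
  one_mem' := ⟨one_mem _, fun n _ => by simp⟩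
  mul_mem' {u v} hu hv := ⟨mul_mem hu.1 hv.1, fun n hn => by
    rw [commutatorElement_mul_left_of_mem hu.1]
    exact mul_mem (hv.2 n hn) (hu.2 n hn)⟩
  inv_mem' {u} hu := ⟨inv_mem hu.1, fun n hn => by
    have h := commutatorElement_mul_left_of_mem hu.1 u⁻¹ n
    rw [mul_inv_cancel, commutatorElement_one_left] at h
    rw [eq_inv_of_mul_eq_one_left h.symm]
    exact inv_mem (hu.2 n hn)⟩

theorem mem_centerModulo {C : Subgroup H} {v : H} : v ∈ centerModulo C ↔
    v ∈ commutatorCentralizer H ∧ ∀ n ∈ commutatorCentralizer H, ⁅v, n⁆ ∈ C := Iff.rfl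

/-- The extra factor `commutatorCentralizer H` matters only for an empty family. -/
theorem centerModulo_inf_iInf {ι : Type*} (f : ι → Subgroup H) :
    commutatorCentralizer H ⊓ ⨅ i, centerModulo (f i) ≤
      centerModulo (commutator H ⊓ ⨅ i, f i) := by
  intro v hv
  rw [Subgroup.mem_inf, Subgroup.mem_iInf] at hv
  refine ⟨hv.1, fun n hn => ?_⟩
  rw [Subgroup.mem_inf, Subgroup.mem_iInf]
  exact ⟨commutatorElement_mem_commutator v n, fun i => (hv.2 i).2 n hn⟩

/-- The commutator subgroup and its centralizer are characteristic. For inner automorphisms this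
makes `essentialCommutator` normal. -/
theorem centerModulo_comap (e : H ≃* H) (C : Subgroup H) :
    centerModulo (C.comap (e : H →* H)) = (centerModulo C).comap (e : H →* H) := by
  have key : ∀ (e : H ≃* H) (v : H), v ∈ commutatorCentralizer H →
      e v ∈ commutatorCentralizer H := by
    intro e v hv
    rw [Subgroup.mem_centralizer_iff] at hv ⊢
    intro h hh
    have hc : e.symm h ∈ commutator H := by
      have := Subgroup.mem_map_of_mem (e.symm : H →* H) hh
      have hmap : (commutator H).map (e.symm : H →* H) ≤ commutator H := by
        rw [commutator_def, Subgroup.map_commutator]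
        exact Subgroup.commutator_mono le_top le_top
      exact hmap this
    have := congrArg e (hv _ hc)
    simpa using this
  ext v
  rw [Subgroup.mem_comap, mem_centerModulo, mem_centerModulo]
  refine ⟨fun h => ⟨key e v h.1, fun n hn => ?_⟩, fun h => ⟨?_, fun n hn => ?_⟩⟩
  · have := h.2 _ (key e.symm n hn)
    rw [Subgroup.mem_comap, map_commutatorElement] at this
    simpa using this
  · simpa using key e.symm _ h.1
  · rw [Subgroup.mem_comap, map_commutatorElement]
    exact h.2 _ (key e n hn)

variable (H) in
/-- The intersection of all subgroups of the commutator subgroup modulo which the centralizer of the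
commutator subgroup has a center of index at most `B`. -/
def essentialCommutator (B : ℕ) : Subgroup H :=
  commutator H ⊓ ⨅ C : {C : Subgroup H // C ≤ commutator H ∧ (centerModulo C).index ≤ B}, C.1

variable (H) in
theorem essentialCommutator_le_commutator (B : ℕ) : essentialCommutator H B ≤ commutator H :=
  inf_le_left

theorem essentialCommutator_le {B : ℕ} {C : Subgroup H} (hC : C ≤ commutator H)
    (hB : (centerModulo C).index ≤ B) : essentialCommutator H B ≤ C :=
  inf_le_right.trans (iInf_le (fun C : {C : Subgroup H //
    C ≤ commutator H ∧ (centerModulo C).index ≤ B} => C.1) ⟨C, hC, hB⟩)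

variable (H) in
theorem essentialCommutator_antitone : Antitone (essentialCommutator H) := fun _ _ h =>
  inf_le_inf_left _ (le_iInf fun C => iInf_le_of_le ⟨C.1, C.2.1, C.2.2.trans h⟩ le_rfl)

instance essentialCommutator_normal (B : ℕ) : (essentialCommutator H B).Normal := by
  refine ⟨fun l hl g => ?_⟩
  rw [essentialCommutator, Subgroup.mem_inf, Subgroup.mem_iInf] at hl ⊢
  refine ⟨Subgroup.Normal.conj_mem inferInstance l hl.1 g, fun C => ?_⟩
  have h1 : C.1.comap (MulAut.conj g : H →* H) ≤ commutator H := by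
    intro x hx
    have := Subgroup.Normal.conj_mem (inferInstance : (commutator H).Normal) _ (C.2.1 hx) g⁻¹
    simpa [mul_assoc] using this
  have h2 : (centerModulo (C.1.comap (MulAut.conj g : H →* H))).index ≤ B := by
    rw [centerModulo_comap, Subgroup.index_comap_of_surjective _ (MulAut.conj g).surjective]
    exact C.2.2
  have := hl.2 ⟨_, h1, h2⟩
  simpa using this

variable [Finite H]

theorem index_centralizer_le_card_commutator (g : H) :
    (Subgroup.centralizer {g}).index ≤ Nat.card (commutator H) := by
  rw [← ncard_range_conj]
  have : (Set.range fun x : H => x * g * x⁻¹) ⊆ (· * g) '' (commutator H : Set H) := by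
    rintro _ ⟨x, rfl⟩
    refine ⟨⁅x, g⁆, commutatorElement_mem_commutator x g, ?_⟩
    simp [commutatorElement_def]
  exact (Set.ncard_le_ncard this).trans (Set.ncard_image_le)

omit [Finite H] in
theorem index_iInf_le_pow {ι : Type*} [Finite ι] (f : ι → Subgroup H) {B : ℕ}
    (h : ∀ i, (f i).index ≤ B) : (⨅ i, f i).index ≤ B ^ Nat.card ι := by
  have := Fintype.ofFinite ι
  refine (Subgroup.index_iInf_le _).trans ((Finset.prod_le_pow_card _ _ B fun i _ => h i).trans ?_)
  rw [Finset.card_univ, Nat.card_eq_fintype_card]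

theorem index_commutatorCentralizer_le :
    (commutatorCentralizer H).index ≤ Nat.card (commutator H) ^ Nat.card (commutator H) := by
  have : commutatorCentralizer H = ⨅ c : commutator H, Subgroup.centralizer {(c : H)} := by
    ext x
    rw [Subgroup.mem_iInf, Subgroup.mem_centralizer_iff]
    exact ⟨fun h c => Subgroup.mem_centralizer_singleton_iff.2 (h c c.2).symm,
      fun h c hc => (Subgroup.mem_centralizer_singleton_iff.1 (h ⟨c, hc⟩)).symm⟩
  rw [this]
  exact index_iInf_le_pow _ fun c => index_centralizer_le_card_commutator _

theorem card_subgroups_le_commutator_le :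
    Nat.card {C : Subgroup H // C ≤ commutator H} ≤ 2 ^ Nat.card (commutator H) := by
  have h : Function.Injective fun C : {C : Subgroup H // C ≤ commutator H} =>
      ((↑) : commutator H → H) ⁻¹' (C.1 : Set H) := by
    intro C D h
    refine Subtype.ext (SetLike.ext fun x => ?_)
    by_cases hx : x ∈ commutator H
    · exact Set.ext_iff.1 h ⟨x, hx⟩
    · exact ⟨fun h => absurd (C.2 h) hx, fun h => absurd (D.2 h) hx⟩
  have := Fintype.ofFinite (commutator H)
  refine (Nat.card_le_card_of_injective _ h).trans ?_
  rw [Nat.card_eq_fintype_card, Fintype.card_set, Nat.card_eq_fintype_card]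

theorem index_centerModulo_essentialCommutator_le (B : ℕ) :
    (centerModulo (essentialCommutator H B)).index ≤
      Nat.card (commutator H) ^ Nat.card (commutator H) *
        (B + 1) ^ 2 ^ Nat.card (commutator H) := by
  refine (Subgroup.index_antitone (centerModulo_inf_iInf _)).trans
    (Subgroup.index_inf_le.trans (Nat.mul_le_mul index_commutatorCentralizer_le ?_))
  -- Replacing `B` by `B + 1` keeps the base positive, so the exponent may be raised to the count of
  -- all subgroups of the commutator subgroup.
  refine (index_iInf_le_pow _ fun C => C.2.2.trans B.le_succ).trans
    (Nat.pow_le_pow_right B.succ_pos ?_)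
  refine le_trans ?_ card_subgroups_le_commutator_le
  exact Nat.card_le_card_of_injective (fun C => ⟨C.1, C.2.1⟩)
    (fun C D h => Subtype.ext (Subtype.mk.inj h))

/-- The center of the quotient by the essential commutator subgroup has bounded index. -/
theorem index_center_quotient_le (L : Subgroup H) [L.Normal] :
    (Subgroup.center (H ⧸ L)).index ≤ (centerModulo L).index *
      Nat.card (commutator H) ^ (commutatorCentralizer H).index := by
  -- Write `w = t * u` with `t` a coset representative commuting with `v` and `u` centralizing the
  -- commutator subgroup; then `⁅v, w⁆ = t * ⁅v, u⁆ * t⁻¹`.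
  have h1 : centerModulo L ⊓ ⨅ q : H ⧸ commutatorCentralizer H, Subgroup.centralizer {q.out} ≤
      (Subgroup.center (H ⧸ L)).comap (QuotientGroup.mk' L) := by
    intro v hv
    rw [Subgroup.mem_inf, Subgroup.mem_iInf] at hv
    rw [Subgroup.mem_comap, Subgroup.mem_center_iff]
    intro y
    obtain ⟨w, rfl⟩ := QuotientGroup.mk'_surjective L y
    set t := ((w : H ⧸ commutatorCentralizer H)).out with ht
    have hu : t⁻¹ * w ∈ commutatorCentralizer H := QuotientGroup.eq.1 (QuotientGroup.out_eq' _)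
    have hvt := Subgroup.mem_centralizer_singleton_iff.1 (hv.2 (w : H ⧸ commutatorCentralizer H))
    rw [← ht] at hvt
    have hL : ⁅v, w⁆ ∈ L := by
      have := Subgroup.Normal.conj_mem inferInstance _ (hv.1.2 _ hu) t
      convert this using 1
      have hvt' : v = t * v * t⁻¹ := by rw [← hvt, mul_inv_cancel_right]
      simp only [commutatorElement_def]
      calc v * w * v⁻¹ * w⁻¹ = (t * v * t⁻¹) * w * v⁻¹ * w⁻¹ := by rw [← hvt']
        _ = _ := by group
    have h2 : ⁅QuotientGroup.mk' L v, QuotientGroup.mk' L w⁆ = 1 := by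
      rw [← map_commutatorElement]
      exact (QuotientGroup.eq_one_iff _).2 hL
    exact (commutatorElement_eq_one_iff_mul_comm.1 h2).symm
  rw [← Subgroup.index_comap_of_surjective _ (QuotientGroup.mk'_surjective L)]
  refine (Subgroup.index_antitone h1).trans (Subgroup.index_inf_le.trans (Nat.mul_le_mul_left _ ?_))
  exact index_iInf_le_pow _ fun q => index_centralizer_le_card_commutator _

/-- If `v` and `w` share a coset and both have range `C`, then `⁅v * w⁻¹, n⁆ = ⁅w, n⁆⁻¹ * ⁅v, n⁆ ∈
C`, so `v * w⁻¹` lies in `centerModulo C`. -/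
theorem ncard_range_commutatorHom_eq_le (C : Subgroup H) :
    {v : H | (commutatorHom v).range = C}.ncard ≤
      Nat.card (centerModulo C) * (commutatorCentralizer H).index := by
  classical
  have := Fintype.ofFinite H
  have := Fintype.ofFinite (H ⧸ commutatorCentralizer H)
  rw [Set.ncard_eq_toFinset_card', Subgroup.index, Nat.card_eq_fintype_card (α := H ⧸ _),
    ← Finset.card_univ (α := H ⧸ _)]
  refine Finset.card_le_mul_card_image_of_maps_to
    (f := fun v : H => (v : H ⧸ commutatorCentralizer H)) (fun _ _ => Finset.mem_univ _) _
    (fun q _ => ?_)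
  rcases Finset.eq_empty_or_nonempty
    (Finset.filter (fun v : H => (v : H ⧸ commutatorCentralizer H) = q)
      {v : H | (commutatorHom v).range = C}.toFinset) with he | ⟨w, hw⟩
  · rw [he]; simp
  rw [← Set.ncard_coe_finset]
  refine (Set.ncard_le_ncard (t := (· * w) '' (centerModulo C : Set H)) ?_).trans
    Set.ncard_image_le
  intro v hv
  simp only [Finset.coe_filter, Finset.mem_filter, Set.mem_toFinset, Set.mem_ofPred_eq] at hv hw
  refine ⟨v * w⁻¹, ?_, by simp⟩
  have hm : v * w⁻¹ ∈ commutatorCentralizer H := by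
    have h := QuotientGroup.eq.1 (hw.2.trans hv.2.symm)
    have := Subgroup.Normal.conj_mem inferInstance _ h w
    simpa [mul_assoc] using this
  refine ⟨hm, fun n hn => ?_⟩
  have h := commutatorElement_mul_left_of_mem hm w n
  rw [inv_mul_cancel_right] at h
  have hv' : ⁅v, n⁆ ∈ C := hv.1 ▸ ⟨⟨n, hn⟩, rfl⟩
  have hw' : ⁅w, n⁆ ∈ C := hw.1 ▸ ⟨⟨n, hn⟩, rfl⟩
  rw [eq_comm, ← eq_inv_mul_iff_mul_eq] at h
  rw [h]
  exact mul_mem (inv_mem hw') hv'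

/-- If every subgroup of the commutator subgroup not containing `L` has small `centerModulo`, then
few elements have commutators failing to cover `L`. -/
theorem ncard_not_le_range_commutatorHom_le (L : Subgroup H) (B : ℕ)
    (hB : ∀ C ≤ commutator H, (centerModulo C).index ≤ B → L ≤ C) :
    B * {v : H | ¬ L ≤ (commutatorHom v).range}.ncard ≤
      2 ^ Nat.card (commutator H) *
        Nat.card (commutator H) ^ Nat.card (commutator H) * Nat.card H := by
  have hsub : {v : H | ¬ L ≤ (commutatorHom v).range} ⊆
      ⋃ C : {C : Subgroup H // C ≤ commutator H},
        {v : H | (commutatorHom v).range = C.1 ∧ ¬ L ≤ C.1} := by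
    intro v hv
    refine Set.mem_iUnion.2 ⟨⟨(commutatorHom v).range, ?_⟩, rfl, hv⟩
    rintro _ ⟨n, rfl⟩
    exact commutatorElement_mem_commutator _ _
  have := Fintype.ofFinite {C : Subgroup H // C ≤ commutator H}
  have h1 : ∀ C : {C : Subgroup H // C ≤ commutator H},
      B * {v : H | (commutatorHom v).range = C.1 ∧ ¬ L ≤ C.1}.ncard ≤
        Nat.card (commutator H) ^ Nat.card (commutator H) * Nat.card H := by
    rintro ⟨C, hC⟩
    by_cases hL : L ≤ C
    · simp [hL]
    have h2 : B ≤ (centerModulo C).index := by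
      by_contra! h
      exact hL (hB C hC h.le)
    calc _ ≤ B * (Nat.card (centerModulo C) * (commutatorCentralizer H).index) :=
          Nat.mul_le_mul_left _ ((Set.ncard_le_ncard fun v hv => hv.1).trans
            (ncard_range_commutatorHom_eq_le C))
      _ ≤ (centerModulo C).index * (Nat.card (centerModulo C) *
            Nat.card (commutator H) ^ Nat.card (commutator H)) :=
          Nat.mul_le_mul h2 (Nat.mul_le_mul_left _ index_commutatorCentralizer_le)
      _ = Nat.card (commutator H) ^ Nat.card (commutator H) *
            (Nat.card (centerModulo C) * (centerModulo C).index) := by ring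
      _ = _ := by rw [Subgroup.card_mul_index]
  refine (Nat.mul_le_mul_left _ ((Set.ncard_le_ncard hsub).trans
    (Set.ncard_iUnion_le_of_fintype _))).trans ?_
  rw [Finset.mul_sum]
  refine (Finset.sum_le_card_nsmul _ _ _ fun C _ => h1 C).trans ?_
  rw [smul_eq_mul, mul_assoc, Finset.card_univ, ← Nat.card_eq_fintype_card]
  exact Nat.mul_le_mul_right _ card_subgroups_le_commutator_le

/-- Choose `n l` with `⁅v, n l⁆ = l`. Left multiplication by `n l` carries the centralizer of `v`
into the elements whose commutator with `v` is `l`, and these sets are disjoint for distinct `l`. -/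
theorem card_mul_ncard_commuting_le (L : Subgroup H) {v : H}
    (hv : L ≤ (commutatorHom v).range) :
    Nat.card L * {w : H | Commute v w}.ncard ≤ {w : H | ⁅v, w⁆ ∈ L}.ncard := by
  choose n hn using fun l : L => hv l.2
  rw [← Nat.card_coe_set_eq, ← Nat.card_coe_set_eq, ← Nat.card_prod]
  have key : ∀ (l : L) (w : H), Commute v w → ⁅v, (n l : H) * w⁆ = l := by
    intro l w hw
    rw [commutatorElement_mul_right_of_mem (n l).2, commutatorElement_eq_one_iff_commute.2 hw,
      mul_one]
    exact hn l
  refine Nat.card_le_card_of_injective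
    (fun p : L × {w : H | Commute v w} => ⟨(n p.1 : H) * p.2, ?_⟩) ?_
  · change ⁅v, (n p.1 : H) * p.2⁆ ∈ L
    rw [key _ _ p.2.2]
    exact p.1.2
  · rintro ⟨l, w, hw⟩ ⟨l', w', hw'⟩ h
    have h1 : (n l : H) * w = n l' * w' := congrArg Subtype.val h
    have h2 : l = l' := by
      refine Subtype.ext ?_
      rw [← key l w hw, ← key l' w' hw', h1]
    subst h2
    simpa using h1

theorem ncard_eq_sum_fibers {α β : Type*} [Fintype α] [Finite β] (s : Set (α × β)) :
    s.ncard = ∑ a, {b | (a, b) ∈ s}.ncard := by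
  rw [← Nat.card_coe_set_eq]
  simp_rw [← Nat.card_coe_set_eq]
  rw [← Nat.card_sigma]
  exact Nat.card_congr ⟨fun p => ⟨p.1.1, p.1.2, p.2⟩, fun p => ⟨(p.1, p.2.1), p.2.2⟩,
    fun _ => rfl, fun _ => rfl⟩

omit [Finite H] in
theorem ncard_preimage_mk (L : Subgroup H) (t : Set (H ⧸ L)) :
    {w : H | (w : H ⧸ L) ∈ t}.ncard = Nat.card L * t.ncard := by
  rw [← Nat.card_coe_set_eq, ← Nat.card_coe_set_eq t, ← Nat.card_prod]
  exact Nat.card_congr (QuotientGroup.preimageMkEquivSubgroupProdSet L t)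

theorem ncard_preimage_mk_snd {α : Type*} [Finite α] (L : Subgroup H) (t : Set (α × (H ⧸ L))) :
    {p : α × H | (p.1, (p.2 : H ⧸ L)) ∈ t}.ncard = Nat.card L * t.ncard := by
  have := Fintype.ofFinite α
  rw [ncard_eq_sum_fibers, ncard_eq_sum_fibers t, Finset.mul_sum]
  exact Finset.sum_congr rfl fun a _ => ncard_preimage_mk L {y | (a, y) ∈ t}

theorem ncard_preimage_mk_prod (L : Subgroup H) (t : Set ((H ⧸ L) × (H ⧸ L))) :
    {p : H × H | ((p.1 : H ⧸ L), (p.2 : H ⧸ L)) ∈ t}.ncard = t.ncard * Nat.card L ^ 2 := by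
  have h1 := ncard_preimage_mk_snd (α := H) L {p | ((p.1 : H ⧸ L), p.2) ∈ t}
  have h2 := ncard_preimage_mk_snd (α := H ⧸ L) L (Prod.swap ⁻¹' t)
  have h3 : (Prod.swap ⁻¹' t).ncard = t.ncard :=
    Set.ncard_preimage_of_injective_subset_range Prod.swap_injective (by
      rw [Prod.swap_surjective.range_eq]; exact Set.subset_univ _)
  have h4 : {p : (H ⧸ L) × H | (p.1, (p.2 : H ⧸ L)) ∈ Prod.swap ⁻¹' t}.ncard =
      {p : H × (H ⧸ L) | ((p.1 : H ⧸ L), p.2) ∈ t}.ncard :=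
    Set.ncard_preimage_of_injective_subset_range
      (s := {p : H × (H ⧸ L) | ((p.1 : H ⧸ L), p.2) ∈ t}) Prod.swap_injective (by
      rw [Prod.swap_surjective.range_eq]; exact Set.subset_univ _)
  calc _ = Nat.card L * {p : H × (H ⧸ L) | ((p.1 : H ⧸ L), p.2) ∈ t}.ncard := h1
    _ = Nat.card L * (Nat.card L * t.ncard) := by rw [← h4, h2, h3]
    _ = _ := by ring

theorem ncard_commutatorElement_mem (L : Subgroup H) [L.Normal] :
    {p : H × H | ⁅p.1, p.2⁆ ∈ L}.ncard =
      {p : (H ⧸ L) × (H ⧸ L) | Commute p.1 p.2}.ncard * Nat.card L ^ 2 := by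
  rw [← ncard_preimage_mk_prod]
  congr
  ext p
  change ⁅p.1, p.2⁆ ∈ L ↔ Commute (QuotientGroup.mk' L p.1) (QuotientGroup.mk' L p.2)
  rw [← commutatorElement_eq_one_iff_commute, ← map_commutatorElement]
  exact (QuotientGroup.eq_one_iff _).symm

/-- The effect on the commuting probability of dividing out by a normal subgroup which is covered by
the commutators of most elements. -/
theorem commProb_le_quotient_add (L : Subgroup H) [L.Normal] :
    (commProb H : ℝ) ≤ commProb (H ⧸ L) / Nat.card L +
      {v : H | ¬ L ≤ (commutatorHom v).range}.ncard / Nat.card H := by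
  classical
  have := Fintype.ofFinite H
  have hcount : Nat.card L * {p : H × H | Commute p.1 p.2}.ncard ≤
      {p : H × H | ⁅p.1, p.2⁆ ∈ L}.ncard +
        {v : H | ¬ L ≤ (commutatorHom v).range}.ncard * (Nat.card L * Nat.card H) := by
    rw [ncard_eq_sum_fibers, ncard_eq_sum_fibers {p : H × H | ⁅p.1, p.2⁆ ∈ L}, Finset.mul_sum,
      Set.ncard_eq_toFinset_card', ← smul_eq_mul (a := Finset.card _), ← Finset.sum_const,
      Set.toFinset_ofPred, Finset.sum_filter, ← Finset.sum_add_distrib]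
    refine Finset.sum_le_sum fun v _ => ?_
    by_cases hv : L ≤ (commutatorHom v).range
    · exact (card_mul_ncard_commuting_le L hv).trans (Nat.le_add_right _ _)
    · rw [if_pos hv]
      exact (Nat.mul_le_mul_left _ (Set.ncard_le_card _)).trans (Nat.le_add_left _ _)
  rw [ncard_commutatorElement_mem] at hcount
  have hL : (0 : ℝ) < Nat.card L := Nat.cast_pos.2 Nat.card_pos
  have hQ : (0 : ℝ) < Nat.card (H ⧸ L) := Nat.cast_pos.2 Nat.card_pos
  have hH : (Nat.card H : ℝ) = Nat.card (H ⧸ L) * Nat.card L := by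
    exact_mod_cast Subgroup.card_eq_card_quotient_mul_card_subgroup L
  rw [commProb_eq_ncard_div, commProb_eq_ncard_div]
  have hcount' : (Nat.card L : ℝ) * {p : H × H | Commute p.1 p.2}.ncard ≤
      {p : (H ⧸ L) × (H ⧸ L) | Commute p.1 p.2}.ncard * (Nat.card L : ℝ) ^ 2 +
        {v : H | ¬ L ≤ (commutatorHom v).range}.ncard * (Nat.card L * Nat.card H) := by
    exact_mod_cast hcount
  rw [hH] at hcount' ⊢
  rw [div_le_iff₀ (by positivity)]
  refine le_of_mul_le_mul_left (hcount'.trans (le_of_eq ?_)) hL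
  field_simp

/-- A quantitative version of `commProb_le_quotient_add` for an essential commutator subgroup. -/
theorem commProb_le_quotient_add_div (L : Subgroup H) [L.Normal] {B : ℕ} (hB0 : 0 < B)
    (hB : ∀ C ≤ commutator H, (centerModulo C).index ≤ B → L ≤ C) :
    (commProb H : ℝ) ≤ commProb (H ⧸ L) / Nat.card L +
      (2 ^ Nat.card (commutator H) * Nat.card (commutator H) ^ Nat.card (commutator H) : ℕ) / B := by
  refine (commProb_le_quotient_add L).trans (add_le_add le_rfl ?_)
  have hH : (0 : ℝ) < Nat.card H := Nat.cast_pos.2 Nat.card_pos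
  rw [div_le_div_iff₀ hH (Nat.cast_pos.2 hB0), mul_comm]
  exact_mod_cast ncard_not_le_range_commutatorHom_le L B hB

end CommutatorCentralizer

/-- The commuting probability is a fraction of bounded height when the center has bounded index. -/
theorem commProb_eq_div_index_center_sq (H : Type*) [Group H] [Finite H] :
    ∃ c : ℕ, c ≤ (Subgroup.center H).index ^ 2 ∧
      (commProb H : ℝ) = c / ((Subgroup.center H).index : ℝ) ^ 2 := by
  set Z := Subgroup.center H
  -- Whether two elements commute depends only on their cosets modulo the center.
  refine ⟨{p : (H ⧸ Z) × (H ⧸ Z) | Commute p.1.out p.2.out}.ncard, ?_, ?_⟩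
  · refine (Set.ncard_le_card _).trans ?_
    rw [Nat.card_prod, sq, Subgroup.index_eq_card]
  have h1 := ncard_preimage_mk_prod Z {p : (H ⧸ Z) × (H ⧸ Z) | Commute p.1.out p.2.out}
  have h2 : {p : H × H | ((p.1 : H ⧸ Z), (p.2 : H ⧸ Z)) ∈
      {p : (H ⧸ Z) × (H ⧸ Z) | Commute p.1.out p.2.out}} = {p : H × H | Commute p.1 p.2} := by
    ext ⟨g, h⟩
    obtain ⟨y, hy⟩ := QuotientGroup.mk_out_eq_mul Z g
    obtain ⟨z, hz⟩ := QuotientGroup.mk_out_eq_mul Z h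
    have hyc : ∀ x, Commute (y : H) x := fun x => (Subgroup.mem_center_iff.1 y.2 x).symm
    have hzc : ∀ x, Commute x (z : H) := fun x => Subgroup.mem_center_iff.1 z.2 x
    change Commute (g : H ⧸ Z).out (h : H ⧸ Z).out ↔ Commute g h
    rw [hy, hz]
    refine ⟨fun hc => ?_, fun hc =>
      (hc.mul_left (hyc h)).mul_right (hzc _)⟩
    have h3 := ((hc.mul_left (hyc _).inv_left).mul_right (hzc (g * y * (y : H)⁻¹)).inv_right)
    simpa using h3
  rw [h2] at h1
  have hZ : (0 : ℝ) < Nat.card Z := Nat.cast_pos.2 Nat.card_pos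
  have hi : (0 : ℝ) < Z.index := Nat.cast_pos.2 (Nat.pos_of_ne_zero Z.index_ne_zero_of_finite)
  rw [commProb_eq_ncard_div, h1, ← Z.card_mul_index]
  push_cast
  field_simp

/-! ### Limits of commuting probabilities along an ultrafilter -/

section UltrafilterLimits

open Filter Topology

theorem Ultrafilter.exists_eventually_eq {α β : Type*} (U : Ultrafilter α) (f : α → β) {S : Set β}
    (hS : S.Finite) (h : ∀ᶠ n in U, f n ∈ S) : ∃ c ∈ S, ∀ᶠ n in U, f n = c := by
  have : (⋃ c ∈ S, {n | f n = c}) ∈ U := by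
    filter_upwards [h] with n hn
    exact Set.mem_biUnion hn rfl
  exact (Ultrafilter.finite_biUnion_mem_iff hS).1 this

/-- A bounded antitone sequence of functions is eventually constant, modulo an ultrafilter. -/
theorem Ultrafilter.exists_forall_ge_eventually_eq {α : Type*} (U : Ultrafilter α)
    (f : ℕ → α → ℕ) (hf : ∀ n, Antitone fun r => f r n) {B r₀ : ℕ}
    (hB : ∀ r ≥ r₀, ∀ n, f r n ≤ B) :
    ∃ R ≥ r₀, ∃ c, ∀ r ≥ R, ∀ᶠ n in U, f r n = c := by
  have h1 : ∀ r, ∃ c, ∀ᶠ n in U, f (r₀ + r) n = c := fun r => by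
    obtain ⟨c, -, hc⟩ := U.exists_eventually_eq (f (r₀ + r)) (Set.finite_Iic B)
      (Eventually.of_forall fun n => hB _ (Nat.le_add_right _ _) n)
    exact ⟨c, hc⟩
  choose c hc using h1
  -- Past the index of the smallest eventual value, antitonicity leaves no room to decrease.
  set r₁ := Function.argmin c with hr₁
  refine ⟨r₀ + r₁, Nat.le_add_right _ _, c r₁, fun r hr => ?_⟩
  obtain ⟨s, rfl⟩ := Nat.exists_eq_add_of_le ((Nat.le_add_right r₀ r₁).trans hr)
  have hs : c s = c r₁ := by
    obtain ⟨n, hn, hn'⟩ := ((hc s).and (hc r₁)).exists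
    exact le_antisymm (hn ▸ hn' ▸ hf n hr) (Function.argmin_le c s)
  rw [← hs]
  exact hc s

/-- Once the order of `essentialCommutator` stabilises, the same `L n` serves for every larger
cutoff `B`, so the error term, of order `1 / B`, can be made arbitrarily small. -/
theorem exists_limit_of_card_commutator_le (U : Ultrafilter ℕ) (H : ℕ → Type) [∀ n, Group (H n)]
    [∀ n, Finite (H n)] {D : ℕ} (hD : ∀ n, Nat.card (commutator (H n)) ≤ D) :
    ∃ q ∈ commProbSet, ∃ l : ℕ, 1 ≤ l ∧
      (∀ δ > 0, ∀ᶠ n in U, (commProb (H n) : ℝ) ≤ q / l + δ) ∧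
      (∀ᶠ n in U, q / l ≤ commProb (H n)) ∧ (l = 1 → ∀ᶠ n in U, (commProb (H n) : ℝ) = q) := by
  have hD1 : 1 ≤ D := Nat.card_pos.trans_le (hD 0)
  have hpow : ∀ n, Nat.card (commutator (H n)) ^ Nat.card (commutator (H n)) ≤ D ^ D := fun n =>
    (Nat.pow_le_pow_left (hD n) _).trans (Nat.pow_le_pow_right hD1 (hD n))
  obtain ⟨R, -, l, hl⟩ := U.exists_forall_ge_eventually_eq
    (fun B n => Nat.card (essentialCommutator (H n) B))
    (fun n B C h => Nat.card_le_card_of_injective _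
      (Subgroup.inclusion_injective (essentialCommutator_antitone (H n) h)))
    (B := D) (r₀ := 0) (fun B _ n => (Nat.card_le_card_of_injective _
      (Subgroup.inclusion_injective (essentialCommutator_le_commutator (H n) B))).trans (hD n))
  let L : ∀ n, Subgroup (H n) := fun n => essentialCommutator (H n) R
  have hL : ∀ᶠ n in U, Nat.card (L n) = l := hl R le_rfl
  have hl1 : 1 ≤ l := by
    obtain ⟨n, hn⟩ := hL.exists
    rw [← hn]
    exact Nat.card_pos
  have hLB : ∀ B ≥ R, ∀ᶠ n in U, ∀ C ≤ commutator (H n), (centerModulo C).index ≤ B → L n ≤ C := by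
    intro B hB
    filter_upwards [hL, hl B hB] with n h1 h2 C hC hCB
    have : essentialCommutator (H n) B = L n :=
      Subgroup.eq_of_le_of_card_ge (essentialCommutator_antitone (H n) hB) (by rw [h1, h2])
    rw [← this]
    exact essentialCommutator_le hC hCB
  set m := (D ^ D * (R + 1) ^ 2 ^ D) * D ^ D ^ D with hm
  have hcenter : ∀ n, (Subgroup.center (H n ⧸ L n)).index ≤ m := fun n => by
    refine (index_center_quotient_le (L n)).trans (Nat.mul_le_mul
      ((index_centerModulo_essentialCommutator_le R).trans (Nat.mul_le_mul (hpow n) ?_)) ?_)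
    · exact Nat.pow_le_pow_right R.succ_pos (Nat.pow_le_pow_right two_pos (hD n))
    · exact (Nat.pow_le_pow_left (hD n) _).trans
        (Nat.pow_le_pow_right hD1 (index_commutatorCentralizer_le.trans (hpow n)))
  obtain ⟨q, -, hq⟩ := U.exists_eventually_eq (fun n => (commProb (H n ⧸ L n) : ℝ))
    (S := (fun p : ℕ × ℕ => (p.1 : ℝ) / (p.2 : ℝ) ^ 2) '' (Set.Iic (m ^ 2) ×ˢ Set.Iic m))
    (((Set.finite_Iic _).prod (Set.finite_Iic _)).image _)
    (Eventually.of_forall fun n => by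
      obtain ⟨c, hc, hc'⟩ := commProb_eq_div_index_center_sq (H n ⧸ L n)
      exact ⟨(c, _), ⟨hc.trans (Nat.pow_le_pow_left (hcenter n) 2), hcenter n⟩, hc'.symm⟩)
  refine ⟨q, ?_, l, hl1, fun δ hδ => ?_, ?_, ?_⟩
  · obtain ⟨n, hn⟩ := hq.exists
    exact ⟨H n ⧸ L n, inferInstance, inferInstance, hn.symm⟩
  · obtain ⟨B, hB⟩ := exists_nat_gt ((2 ^ D * D ^ D : ℕ) / δ)
    filter_upwards [hL, hq, hLB (max (max B R) 1) (by simp)] with n h1 h2 h3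
    refine (commProb_le_quotient_add_div (L n) (by simp) h3).trans ?_
    rw [h1, h2]
    refine add_le_add le_rfl ?_
    rw [div_lt_iff₀ hδ] at hB
    rw [div_le_iff₀ (Nat.cast_pos.2 (by simp))]
    have h4 : (2 ^ Nat.card (commutator (H n)) * Nat.card (commutator (H n)) ^
        Nat.card (commutator (H n)) : ℕ) ≤ 2 ^ D * D ^ D :=
      Nat.mul_le_mul (Nat.pow_le_pow_right two_pos (hD n)) (hpow n)
    have h5 : ((2 ^ D * D ^ D : ℕ) : ℝ) ≤ δ * (max (max B R) 1 : ℕ) := by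
      refine hB.le.trans ?_
      rw [mul_comm]
      exact mul_le_mul_of_nonneg_left (Nat.cast_le.2 (by simp)) hδ.le
    exact (Nat.cast_le.2 h4).trans h5
  · filter_upwards [hL, hq] with n h1 h2
    rw [div_le_iff₀ (Nat.cast_pos.2 hl1), ← h2, ← h1]
    exact_mod_cast (L n).commProb_quotient_le
  -- With `L n` trivial no element is exceptional, so the two bounds agree exactly.
  · rintro rfl
    filter_upwards [hL, hq] with n h1 h2
    have h3 := (L n).commProb_quotient_le
    have h4 := commProb_le_quotient_add (L n)
    have h5 : {v : H n | ¬ L n ≤ (commutatorHom v).range} = ∅ := by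
      rw [Subgroup.eq_bot_of_card_eq _ h1]
      simp
    rw [h5, h1] at h4
    rw [h1] at h3
    have h3' : (commProb (H n ⧸ L n) : ℝ) ≤ commProb (H n) := by
      exact_mod_cast (by simpa using h3 : commProb (H n ⧸ L n) ≤ commProb (H n))
    rw [← h2]
    exact le_antisymm (by simpa using h4) h3'

/-- The structure of limits of commuting probabilities. -/
theorem exists_limit_commProb (U : Ultrafilter ℕ) (G : ℕ → Type) [∀ n, Group (G n)]
    [∀ n, Finite (G n)] {ε : ℝ} (hε : 0 < ε) (h : ∀ n, ε ≤ commProb (G n)) :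
    ∃ q ∈ commProbSet, ∃ k : ℕ, 1 ≤ k ∧
      Tendsto (fun n => (commProb (G n) : ℝ)) U (𝓝 (q / k)) ∧
      (∀ᶠ n in U, q / k ≤ commProb (G n)) ∧ (k = 1 → ∀ᶠ n in U, (commProb (G n) : ℝ) = q) := by
  obtain ⟨a, ha⟩ := exists_nat_gt (2 / ε)
  have ha0 : (0 : ℝ) < a := (by positivity : (0 : ℝ) < 2 / ε).trans ha
  have ha0' : 0 < a := Nat.cast_pos.1 ha0
  have h' : ∀ n, (2 / a : ℝ) ≤ commProb (G n) := fun n =>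
    ((div_lt_comm₀ hε ha0).1 ha).le.trans (h n)
  obtain ⟨R, hR, i, hi⟩ := U.exists_forall_ge_eventually_eq
    (fun r n => (smallClassSubgroup (G n) r).index)
    (fun n r s hrs => Subgroup.index_antitone (smallClassSubgroup_mono (G n) hrs))
    (B := a) (r₀ := a) (fun r hr n => index_smallClassSubgroup_le ha0' hr (h' n))
  let F : ∀ n, Subgroup (G n) := fun n => smallClassSubgroup (G n) R
  have hF : ∀ᶠ n in U, (F n).index = i := hi R le_rfl
  have hi1 : 1 ≤ i := by
    obtain ⟨n, hn⟩ := hF.exists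
    rw [← hn]
    exact Nat.pos_of_ne_zero Subgroup.index_ne_zero_of_finite
  have hFr : ∀ r ≥ R, ∀ᶠ n in U, ∀ g ∉ F n, r ≤ (Subgroup.centralizer {g}).index := by
    intro r hr
    filter_upwards [hF, hi r hr] with n h1 h2 g hg
    -- Nested subgroups of equal finite index coincide, so elements outside `F n` have classes
    -- larger than any prescribed `r`.
    have h3 : F n = smallClassSubgroup (G n) r := by
      refine (smallClassSubgroup_mono (G n) hr).eq_of_not_lt fun hlt => ?_
      exact (Subgroup.index_strictAnti hlt).ne (h2.trans h1.symm)
    rw [h3] at hg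
    exact (lt_index_centralizer_of_notMem_smallClassSubgroup hg).le
  obtain ⟨D, hD⟩ := exists_card_commutator_le (R ^ (3 * a))
  obtain ⟨q, hq, l, hl1, hup, hlow, hone⟩ := exists_limit_of_card_commutator_le U (fun n => F n)
    (D := D) (fun n => hD (F n) fun g => ((F n).index_centralizer_subtype_le g).trans
      (index_centralizer_le_of_mem_smallClassSubgroup ha0' hR (h' n) g.2))
  have hi0 : (0 : ℝ) < i := Nat.cast_pos.2 hi1
  have hl0 : (0 : ℝ) < l := Nat.cast_pos.2 hl1
  have hlow' : ∀ᶠ n in U, q / (i ^ 2 * l : ℕ) ≤ commProb (G n) := by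
    filter_upwards [hF, hlow] with n h1 h2
    have h3 : (commProb (F n) : ℝ) ≤ commProb (G n) * (i : ℝ) ^ 2 := by
      rw [← h1]
      exact_mod_cast (F n).commProb_subgroup_le
    have h4 := h2.trans h3
    push_cast
    rw [mul_comm, ← div_div, div_le_iff₀ (by positivity)]
    exact h4
  -- The factor `i ^ 2` comes from restricting both entries to `F n`, and `l` from the quotient by
  -- the covered subgroup.
  refine ⟨q, hq, i ^ 2 * l, Nat.mul_pos (Nat.pow_pos hi1) hl1, ?_, hlow', ?_⟩
  · refine tendsto_order.2 ⟨fun b hb => ?_, fun b hb => ?_⟩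
    · filter_upwards [hlow'] with n hn using hb.trans_le hn
    · set δ := (b - q / (i ^ 2 * l : ℕ)) / 3 with hδ
      have hδ0 : 0 < δ := by rw [hδ]; linarith
      obtain ⟨r, hr⟩ := exists_nat_gt (2 / δ)
      have hr0 : (0 : ℝ) < r := (by positivity : (0 : ℝ) < 2 / δ).trans hr
      have hr' : 2 / (max r R : ℕ) ≤ δ := by
        refine le_trans ?_ ((div_lt_comm₀ hδ0 hr0).1 hr).le
        exact div_le_div_of_nonneg_left zero_le_two hr0 (Nat.cast_le.2 (le_max_left _ _))
      filter_upwards [hF, hup δ hδ0, hFr (max r R) (le_max_right _ _)] with n h1 h2 h3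
      have h4 := (F n).commProb_le_of_notMem
        ((Nat.cast_pos.1 hr0).trans_le (le_max_left r R)) h3
      rw [h1] at h4
      have h5 : (commProb (F n) : ℝ) / (i : ℝ) ^ 2 ≤ q / (i ^ 2 * l : ℕ) + δ := by
        push_cast
        rw [mul_comm, ← div_div, div_le_iff₀ (by positivity), add_mul,
          div_mul_cancel₀ _ (by positivity)]
        refine h2.trans (add_le_add le_rfl (le_mul_of_one_le_right hδ0.le ?_))
        exact one_le_pow₀ (Nat.one_le_cast.2 hi1)
      linarith
  · intro hk
    obtain ⟨hi', hl'⟩ := mul_eq_one.1 hk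
    have hi'' : i = 1 := by simpa using hi'
    filter_upwards [hF, hone hl'] with n h1 h2
    rw [hi''] at h1
    rw [← h2]
    refine le_antisymm (le_of_forall_pos_le_add fun δ hδ => ?_) ?_
    · obtain ⟨r, hr⟩ := exists_nat_gt (2 / δ)
      have hr0 : (0 : ℝ) < r := (by positivity : (0 : ℝ) < 2 / δ).trans hr
      have h4 := (F n).commProb_le_of_notMem (r := r) (Nat.cast_pos.1 hr0) (fun g hg => by
        rw [Subgroup.index_eq_one.1 h1] at hg
        exact absurd (Subgroup.mem_top g) hg)
      rw [h1] at h4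
      simp only [Nat.cast_one, one_pow, div_one] at h4
      exact h4.trans (add_le_add le_rfl ((div_lt_comm₀ hδ hr0).1 hr).le)
    · have := (F n).commProb_subgroup_le
      rw [h1] at this
      exact_mod_cast (by simpa using this : commProb (F n) ≤ commProb (G n))

theorem exists_limit_of_mem_commProbSet (U : Ultrafilter ℕ) (s : ℕ → ℝ)
    (hs : ∀ n, s n ∈ commProbSet) {ε : ℝ} (hε : 0 < ε) (h : ∀ n, ε ≤ s n) :
    ∃ q ∈ commProbSet, ∃ k : ℕ, 1 ≤ k ∧ Tendsto s U (𝓝 (q / k)) ∧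
      (∀ᶠ n in U, q / k ≤ s n) ∧ (k = 1 → ∀ᶠ n in U, s n = q) := by
  choose G _ _ hG using hs
  obtain rfl : s = fun n => (commProb (G n) : ℝ) := funext hG
  exact exists_limit_commProb U G hε h

end UltrafilterLimits

/-! ### Heisenberg groups and explicit commuting probabilities -/

section Heisenberg

open Matrix

/-- The Heisenberg group of dimension `2 * m + 1` over a commutative ring. -/
@[ext]
structure HeisenbergGroup (R : Type) (m : ℕ) where
  left : Fin m → R
  right : Fin m → R
  center : R

namespace HeisenbergGroup

variable {R : Type} {m : ℕ}

/-- The coordinates of an element of the Heisenberg group. -/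
def equivProd : HeisenbergGroup R m ≃ (Fin m → R) × (Fin m → R) × R where
  toFun g := (g.left, g.right, g.center)
  invFun p := ⟨p.1, p.2.1, p.2.2⟩
  left_inv _ := rfl
  right_inv _ := rfl

instance [Finite R] : Finite (HeisenbergGroup R m) := Finite.of_equiv _ equivProd.symm

theorem card_eq [Finite R] : Nat.card (HeisenbergGroup R m) = Nat.card R ^ (2 * m + 1) := by
  rw [Nat.card_congr equivProd, Nat.card_prod, Nat.card_prod, Nat.card_fun, Nat.card_fin]
  ring

variable [CommRing R]

instance : Mul (HeisenbergGroup R m) :=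
  ⟨fun g h => ⟨g.left + h.left, g.right + h.right, g.center + h.center + g.left ⬝ᵥ h.right⟩⟩

instance : One (HeisenbergGroup R m) := ⟨⟨0, 0, 0⟩⟩

instance : Inv (HeisenbergGroup R m) := ⟨fun g => ⟨-g.left, -g.right, -g.center + g.left ⬝ᵥ g.right⟩⟩

theorem mul_def (g h : HeisenbergGroup R m) : g * h =
    ⟨g.left + h.left, g.right + h.right, g.center + h.center + g.left ⬝ᵥ h.right⟩ := rfl

theorem one_def : (1 : HeisenbergGroup R m) = ⟨0, 0, 0⟩ := rfl

theorem inv_def (g : HeisenbergGroup R m) :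
    g⁻¹ = ⟨-g.left, -g.right, -g.center + g.left ⬝ᵥ g.right⟩ := rfl

instance : Group (HeisenbergGroup R m) := Group.ofLeftAxioms
  (fun g h k => by
    simp only [mul_def, add_dotProduct, dotProduct_add]
    ext <;> simp <;> ring)
  (fun g => by simp [mul_def, one_def])
  (fun g => by simp [mul_def, one_def, inv_def])

theorem commute_iff (g h : HeisenbergGroup R m) :
    Commute g h ↔ g.left ⬝ᵥ h.right - g.right ⬝ᵥ h.left = 0 := by
  rw [sub_eq_zero, commute_iff_eq, dotProduct_comm g.right]
  constructor
  · intro e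
    have := congrArg center e
    simp only [mul_def] at this
    linear_combination this
  · intro e
    simp only [mul_def, HeisenbergGroup.mk.injEq]
    refine ⟨add_comm _ _, add_comm _ _, ?_⟩
    linear_combination e

/-- The symplectic pairing with a fixed element. -/
def pairing (g : HeisenbergGroup R m) : HeisenbergGroup R m →* Multiplicative R where
  toFun h := Multiplicative.ofAdd (g.left ⬝ᵥ h.right - g.right ⬝ᵥ h.left)
  map_one' := by simp [one_def]
  map_mul' h k := by
    rw [← ofAdd_add]
    congr 1
    simp only [mul_def, dotProduct_add]
    ring

theorem ker_pairing (g : HeisenbergGroup R m) :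
    g.pairing.ker = Subgroup.centralizer {g} := by
  ext h
  rw [MonoidHom.mem_ker, Subgroup.mem_centralizer_singleton_iff]
  exact (commute_iff g h).symm.trans Commute.symm_iff

/-- The centralizer is the kernel of `pairing g`, whose image in a group of prime order is
everything because the symplectic form is nondegenerate. -/
theorem index_centralizer {p : ℕ} [Fact p.Prime] (g : HeisenbergGroup (ZMod p) m)
    (hg : ¬ (g.left = 0 ∧ g.right = 0)) : (Subgroup.centralizer {g}).index = p := by
  have hp : Nat.card (Multiplicative (ZMod p)) = p := by
    rw [Nat.card_congr Multiplicative.toAdd, Nat.card_zmod]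
  rw [← ker_pairing, Subgroup.index_ker]
  have hdvd := g.pairing.range.card_subgroup_dvd_card
  rw [hp] at hdvd
  refine ((Nat.dvd_prime Fact.out).1 hdvd).resolve_left fun h1 => hg ?_
  have h2 := Subgroup.eq_bot_of_card_eq _ h1
  have h3 : ∀ h : HeisenbergGroup (ZMod p) m, g.left ⬝ᵥ h.right - g.right ⬝ᵥ h.left = 0 := by
    intro h
    have : g.pairing h ∈ g.pairing.range := ⟨h, rfl⟩
    rw [h2, Subgroup.mem_bot] at this
    exact this
  constructor
  · exact dotProduct_eq_zero _ fun w => by simpa using h3 ⟨0, w, 0⟩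
  · exact dotProduct_eq_zero _ fun w => by simpa using h3 ⟨w, 0, 0⟩

theorem commProb_eq {p : ℕ} [Fact p.Prime] (m : ℕ) :
    (commProb (HeisenbergGroup (ZMod p) m) : ℝ) = 1 / p + (p - 1) / (p : ℝ) ^ (2 * m + 1) := by
  classical
  set G := HeisenbergGroup (ZMod p) m
  have := Fintype.ofFinite G
  have hp0 : 0 < p := (Fact.out : p.Prime).pos
  set Z : Finset G := {g | g.left = 0 ∧ g.right = 0} with hZ
  have hZcard : Z.card = p := by
    have hinj : Function.Injective fun c : ZMod p => (⟨0, 0, c⟩ : G) := fun c d h =>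
      congrArg HeisenbergGroup.center h
    have himage : Z = Finset.univ.image fun c : ZMod p => (⟨0, 0, c⟩ : G) := by
      ext g
      simp only [hZ, Finset.mem_filter, Finset.mem_univ, true_and, Finset.mem_image]
      exact ⟨fun h => ⟨g.center, HeisenbergGroup.ext h.1.symm h.2.symm rfl⟩,
        fun ⟨c, hc⟩ => hc ▸ ⟨rfl, rfl⟩⟩
    rw [himage, Finset.card_image_of_injective _ hinj, Finset.card_univ, ZMod.card]
  have hG : Nat.card G = p ^ (2 * m + 1) := by rw [card_eq, Nat.card_zmod]
  have hfib : ∀ g : G, p * {h : G | Commute g h}.ncard =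
      Nat.card G + if g ∈ Z then (p - 1) * Nat.card G else 0 := by
    intro g
    rw [ncard_commuting_eq_card_centralizer]
    by_cases hg : g ∈ Z
    · rw [if_pos hg]
      have h1 : Nat.card (Subgroup.centralizer {g}) = Nat.card G := by
        have : Subgroup.centralizer {g} = ⊤ := by
          rw [← ker_pairing, eq_top_iff]
          intro h _
          rw [hZ, Finset.mem_filter] at hg
          rw [MonoidHom.mem_ker]
          simp [pairing, hg.2.1, hg.2.2]
        rw [this, Subgroup.card_top]
      rw [h1, ← one_add_mul, show 1 + (p - 1) = p by omega]
    · rw [if_neg hg, add_zero, ← (Subgroup.centralizer {g}).card_mul_index, index_centralizer g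
        (by simpa [hZ] using hg), mul_comm]
  have hcount : p * {q : G × G | Commute q.1 q.2}.ncard =
      Nat.card G * Nat.card G + p * ((p - 1) * Nat.card G) := by
    rw [ncard_eq_sum_fibers, Finset.mul_sum]
    calc _ = ∑ g : G, (Nat.card G + if g ∈ Z then (p - 1) * Nat.card G else 0) :=
          Finset.sum_congr rfl fun g _ => hfib g
      _ = _ := by
        rw [Finset.sum_add_distrib, Finset.sum_ite_mem, Finset.univ_inter, Finset.sum_const,
          Finset.sum_const, hZcard, Finset.card_univ, ← Nat.card_eq_fintype_card, smul_eq_mul,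
          smul_eq_mul]
  have hp' : (0 : ℝ) < p := Nat.cast_pos.2 hp0
  have hcount' : (p : ℝ) * {q : G × G | Commute q.1 q.2}.ncard =
      Nat.card G * Nat.card G + p * ((p - 1) * Nat.card G) := by
    rw [← Nat.cast_pred hp0]
    exact_mod_cast hcount
  rw [commProb_eq_ncard_div]
  rw [hG] at hcount' ⊢
  push_cast at hcount' ⊢
  field_simp
  linear_combination hcount'

end HeisenbergGroup

theorem commProb_mem_commProbSet (G : Type) [Group G] [Finite G] :
    (commProb G : ℝ) ∈ commProbSet := ⟨G, inferInstance, inferInstance, rfl⟩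

theorem mul_mem_commProbSet {x y : ℝ} (hx : x ∈ commProbSet) (hy : y ∈ commProbSet) :
    x * y ∈ commProbSet := by
  obtain ⟨G, _, _, rfl⟩ := hx
  obtain ⟨H, _, _, rfl⟩ := hy
  exact ⟨G × H, inferInstance, inferInstance, by rw [commProb_prod]; push_cast; rfl⟩

theorem one_div_mem_commProbSet {k : ℕ} (hk : 1 ≤ k) : (1 / k : ℝ) ∈ commProbSet := by
  -- An infinite group has commuting probability `0`, so the value `1 / k` itself forces finiteness.
  have hf : Finite (DihedralGroup.Product (DihedralGroup.reciprocalFactors k)) := by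
    by_contra h
    have := not_finite_iff_infinite.1 h
    have h1 := DihedralGroup.commProb_reciprocal k
    rw [commProb_eq_zero_of_infinite] at h1
    have : (0 : ℚ) < 1 / k := by positivity
    exact this.ne h1
  refine ⟨_, inferInstance, hf, ?_⟩
  rw [DihedralGroup.commProb_reciprocal]
  push_cast
  rfl

theorem pos_of_mem_commProbSet {x : ℝ} (hx : x ∈ commProbSet) : 0 < x := by
  obtain ⟨G, _, _, rfl⟩ := hx
  exact_mod_cast commProb_pos G

theorem le_one_of_mem_commProbSet {x : ℝ} (hx : x ∈ commProbSet) : x ≤ 1 := by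
  obtain ⟨G, _, _, rfl⟩ := hx
  exact_mod_cast commProb_le_one G

open Filter Topology in
/-- `1 / p` is a limit of larger commuting probabilities. -/
theorem exists_seq_tendsto_one_div_prime {p : ℕ} (hp : p.Prime) : ∃ s : ℕ → ℝ,
    (∀ n, s n ∈ commProbSet) ∧ (∀ n, s n ≠ 1 / p) ∧ Tendsto s atTop (𝓝 (1 / p)) := by
  have := Fact.mk hp
  have hp1 : (1 : ℝ) < p := Nat.one_lt_cast.2 hp.one_lt
  refine ⟨fun m => 1 / p + (p - 1) / (p : ℝ) ^ (2 * m + 1), fun m => ?_, fun m => ?_, ?_⟩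
  · change 1 / (p : ℝ) + (p - 1) / (p : ℝ) ^ (2 * m + 1) ∈ commProbSet
    rw [← HeisenbergGroup.commProb_eq]
    exact commProb_mem_commProbSet _
  · have : (0 : ℝ) < (p - 1) / (p : ℝ) ^ (2 * m + 1) := div_pos (by linarith) (by positivity)
    linarith
  · have h1 : Tendsto (fun m : ℕ => ((p : ℝ) ^ (2 * m + 1))) atTop atTop :=
      (tendsto_pow_atTop_atTop_of_one_lt hp1).comp
        (tendsto_atTop_mono (fun m => by omega : ∀ m : ℕ, m ≤ 2 * m + 1) tendsto_id)
    simpa using tendsto_const_nhds.add (h1.const_div_atTop ((p : ℝ) - 1))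

end Heisenberg

/-! ### Derived sets and positions in reverse well-ordered sets of reals -/

section ReverseWellOrder

open Filter Topology

theorem mem_derivedSet_iff_forall_lt {A : Set ℝ} {x : ℝ}
    (hbelow : ∃ w < x, ∀ y ∈ A, w < y → x ≤ y) :
    x ∈ derivedSet A ↔ ∀ z > x, ∃ y ∈ A, x < y ∧ y < z := by
  rw [mem_derivedSet, accPt_iff_nhds]
  constructor
  · intro h z hz
    obtain ⟨w, hw, hw'⟩ := hbelow
    obtain ⟨y, ⟨hy, hyA⟩, hne⟩ := h (Set.Ioo w z) (Ioo_mem_nhds hw hz)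
    exact ⟨y, hyA, (hw' y hyA hy.1).lt_of_ne hne.symm, hy.2⟩
  · intro h u hu
    obtain ⟨z, hz, hzu⟩ := exists_Ico_subset_of_mem_nhds hu (exists_gt x)
    obtain ⟨y, hy, hxy, hyz⟩ := h z hz
    exact ⟨y, ⟨hzu ⟨hxy.le, hyz⟩, hy⟩, hxy.ne'⟩

variable {X : Set ℝ} [IsWellOrder X (fun a b : X => b < a)]

/-- Reverse well-ordering provides a largest point of `X` below `x`, so accumulation at `x` happens
only from above. -/
theorem exists_lt_forall_le_of_isWellOrder_gt (x : ℝ) : ∃ w < x, ∀ y ∈ X, w < y → x ≤ y := by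
  by_cases h : ∃ y : X, (y : ℝ) < x
  · obtain ⟨w, hw, hmax⟩ := (IsWellFounded.wf (r := fun a b : X => b < a)).has_min
      {y : X | (y : ℝ) < x} h
    refine ⟨w, hw, fun y hy hwy => ?_⟩
    by_contra! hlt
    exact hmax ⟨y, hy⟩ hlt hwy
  · push Not at h
    exact ⟨x - 1, by linarith, fun y hy _ => h ⟨y, hy⟩⟩

local notation "pos" => Ordinal.typein (fun a b : X => b < a)

/-- Between `x ∈ E (n + 1)` and `y` there are infinitely many points of `E n` descending to `x`. By
induction each adds `ω ^ n` to the position, and the supremum of `ω ^ n * m` is `ω ^ (n + 1)`. -/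
theorem typein_add_opow_le {E : ℕ → Set ℝ} (hEX : ∀ n, E n ⊆ X)
    (hE : ∀ n, E (n + 1) = derivedSet (E n)) (n : ℕ) (x y : X) (hx : (x : ℝ) ∈ E n) (hxy : x < y) :
    pos y + ω ^ (n : Ordinal.{0}) ≤ pos x := by
  induction n generalizing x y with
  | zero =>
    rw [Nat.cast_zero, Ordinal.opow_zero, Order.add_one_le_iff]
    exact (Ordinal.typein_lt_typein _).2 hxy
  | succ n ih =>
    obtain ⟨w, hw, hw'⟩ := exists_lt_forall_le_of_isWellOrder_gt (X := X) (x : ℝ)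
    rw [hE, mem_derivedSet_iff_forall_lt ⟨w, hw, fun z hz => hw' z (hEX n hz)⟩] at hx
    have key : ∀ m : ℕ, ∃ z : X, x < z ∧ pos y + ω ^ (n : Ordinal.{0}) * (m : Ordinal.{0}) ≤ pos z := by
      intro m
      induction m with
      | zero => exact ⟨y, hxy, by simp⟩
      | succ m ihm =>
        obtain ⟨z, hz, hzm⟩ := ihm
        obtain ⟨v, hv, hxv, hvz⟩ := hx z hz
        refine ⟨⟨v, hEX n hv⟩, hxv, ?_⟩
        rw [Nat.cast_succ, mul_add_one, ← add_assoc]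
        exact (add_le_add hzm le_rfl).trans (ih ⟨v, hEX n hv⟩ z hv hvz)
    have hlim : Order.IsNormal fun o : Ordinal.{0} => pos y + ω ^ (n : Ordinal.{0}) * o :=
      (Ordinal.isNormal_add_right _).comp
        (Ordinal.isNormal_mul_right (Ordinal.opow_pos _ Ordinal.omega0_pos))
    rw [Nat.cast_succ, Ordinal.opow_add, Ordinal.opow_one]
    refine (hlim.le_iff_forall_le Ordinal.isSuccLimit_omega0).2 fun o ho => ?_
    obtain ⟨m, rfl⟩ := Ordinal.lt_omega0.1 ho
    obtain ⟨z, hz, hzm⟩ := key m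
    exact hzm.trans ((Ordinal.typein_lt_typein (fun a b : X => b < a)).2 hz).le

/-- Successor multiples of `ω ^ n` are cofinal below `ω ^ n * (ω * c)`, and the points there lie in
`E n` by induction. Their infimum is in `X` by closedness, and cannot exceed `x` since some of them
come after any earlier position. -/
theorem mem_of_typein_eq_opow_mul (hX : IsClosed X) {E : ℕ → Set ℝ} (hE0 : E 0 = X)
    (hEX : ∀ n, E n ⊆ X) (hE : ∀ n, E (n + 1) = derivedSet (E n)) (n : ℕ) (x : X)
    (c : Ordinal.{0}) (hc : c ≠ 0) (hx : pos x = ω ^ (n : Ordinal.{0}) * c) : (x : ℝ) ∈ E n := by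
  induction n generalizing x c with
  | zero => exact hE0 ▸ x.2
  | succ n ih =>
    have hn0 : ω ^ (n : Ordinal.{0}) ≠ 0 := (Ordinal.opow_pos _ Ordinal.omega0_pos).ne'
    rw [Nat.cast_succ, Ordinal.opow_add, Ordinal.opow_one, mul_assoc] at hx
    have hlim : Order.IsSuccLimit (ω * c) :=
      Ordinal.isSuccLimit_mul_left Ordinal.isSuccLimit_omega0 (pos_iff_ne_zero.2 hc)
    -- every earlier position is followed by a point of `E n`
    have key : ∀ o < pos x, ∃ w : X, (w : ℝ) ∈ E n ∧ x < w ∧ o < pos w := by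
      intro o ho
      rw [hx, Ordinal.lt_mul_iff_div_lt hn0] at ho
      have hd := hlim.succ_lt ho
      have hlt : ω ^ (n : Ordinal.{0}) * Order.succ (o / ω ^ (n : Ordinal.{0})) < pos x := by
        rw [hx]
        exact (mul_lt_mul_iff_right₀ (pos_iff_ne_zero.2 hn0)).2 hd
      obtain ⟨w, hw⟩ := Ordinal.typein_surj (fun a b : X => b < a)
        (hlt.trans (Ordinal.typein_lt_type _ x))
      refine ⟨w, ih w _ (Order.succ_ne_bot _) hw, ?_, ?_⟩
      · rw [← hw] at hlt
        exact (Ordinal.typein_lt_typein (fun a b : X => b < a)).1 hlt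
      · exact hw ▸ Ordinal.lt_mul_succ_div o hn0
    obtain ⟨w, hw, hw'⟩ := exists_lt_forall_le_of_isWellOrder_gt (X := X) (x : ℝ)
    rw [hE, mem_derivedSet_iff_forall_lt ⟨w, hw, fun z hz => hw' z (hEX n hz)⟩]
    set T := {y | y ∈ E n ∧ (x : ℝ) < y} with hT
    have hbdd : BddBelow T := ⟨x, fun y hy => hy.2.le⟩
    have hne : T.Nonempty := by
      have hpos : 0 < pos x := by
        rw [hx]
        exact pos_iff_ne_zero.2 (mul_ne_zero hn0 hlim.ne_bot)
      obtain ⟨w, hwE, hxw, -⟩ := key 0 hpos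
      exact ⟨w, hwE, hxw⟩
    have hinf : sInf T ∈ X :=
      hX.closure_subset_iff.2 (fun y hy => hEX n hy.1) (csInf_mem_closure hne hbdd)
    have hxinf : (x : ℝ) ≤ sInf T := le_csInf hne fun y hy => hy.2.le
    have heq : sInf T = x := by
      refine (hxinf.eq_of_not_lt fun hlt => ?_).symm
      obtain ⟨v, hvE, hxv, hv⟩ := key (pos ⟨sInf T, hinf⟩)
        ((Ordinal.typein_lt_typein (fun a b : X => b < a)).2 hlt)
      have hv' : (v : ℝ) < sInf T := (Ordinal.typein_lt_typein (fun a b : X => b < a)).1 hv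
      exact hv'.not_ge (csInf_le hbdd ⟨hvE, hxv⟩)
    intro z hz
    obtain ⟨y, hy, hyz⟩ := exists_lt_of_csInf_lt hne (heq.trans_lt hz)
    exact ⟨y, hy.1, hy.2, hyz⟩

/-- The position of the last point of a closed reverse well-ordered set of Cantor–Bendixson rank
`ω`. -/
theorem typein_eq_omega0_opow_omega0 (hX : IsClosed X) {E : ℕ → Set ℝ} (hE0 : E 0 = X)
    (hEX : ∀ n, E n ⊆ X) (hE : ∀ n, E (n + 1) = derivedSet (E n)) (x y : X) (hxy : x < y)
    (hx : ∀ n, (x : ℝ) ∈ E n) (huniq : ∀ z : X, (∀ n, (z : ℝ) ∈ E n) → z = x) :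
    pos x = ω ^ (ω : Ordinal.{0}) := by
  refine le_antisymm ?_ ?_
  -- A point at position `ω ^ ω = ω ^ n * ω ^ ω` would lie in every `E n`, hence be `x`.
  · by_contra! hlt
    obtain ⟨z, hz⟩ := Ordinal.typein_surj (fun a b : X => b < a)
      (hlt.trans (Ordinal.typein_lt_type _ x))
    refine hlt.ne ?_
    rw [← hz, huniq z fun n => ?_]
    refine mem_of_typein_eq_opow_mul hX hE0 hEX hE n z (ω ^ (ω : Ordinal.{0}))
      (Ordinal.opow_pos _ Ordinal.omega0_pos).ne' ?_
    rw [hz, ← Ordinal.opow_add, Ordinal.natCast_add_omega0]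
  · refine ((Ordinal.isNormal_opow Ordinal.one_lt_omega0).le_iff_forall_le
      Ordinal.isSuccLimit_omega0).2 fun o ho => ?_
    obtain ⟨n, rfl⟩ := Ordinal.lt_omega0.1 ho
    exact le_add_self.trans (typein_add_opow_le hEX hE n x y (hx n) hxy)

end ReverseWellOrder

/-! ### Derived sets of the commuting probabilities -/

section DerivedSets

open Filter Topology

/-- Commuting probabilities, together with zero. -/
def commProbSetZero : Set ℝ := commProbSet ∪ {0}

/-- The commuting probabilities divided by integers with at least `n` prime factors. -/
def commProbLayer (n : ℕ) : Set ℝ :=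
  ⋃ (k : ℕ) (_ : 1 ≤ k ∧ n ≤ ArithmeticFunction.cardFactors k), (1 / (k : ℝ)) • commProbSetZero

theorem zero_mem_commProbSetZero : (0 : ℝ) ∈ commProbSetZero := Or.inr rfl

theorem mem_one_div_smul {k : ℕ} {A : Set ℝ} {x : ℝ} :
    x ∈ (1 / (k : ℝ)) • A ↔ ∃ y ∈ A, x = y / k := by
  simp only [Set.mem_smul_set, smul_eq_mul, one_div_mul_eq_div, eq_comm]

theorem mem_commProbLayer {n : ℕ} {x : ℝ} : x ∈ commProbLayer n ↔
    ∃ k : ℕ, (1 ≤ k ∧ n ≤ ArithmeticFunction.cardFactors k) ∧ ∃ y ∈ commProbSetZero, x = y / k := by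
  simp only [commProbLayer, Set.mem_iUnion, mem_one_div_smul, exists_prop]

theorem div_mem_commProbSet {x : ℝ} (hx : x ∈ commProbSet) {k : ℕ} (hk : 1 ≤ k) :
    x / k ∈ commProbSet := by
  rw [div_eq_mul_one_div]
  exact mul_mem_commProbSet hx (one_div_mem_commProbSet hk)

theorem div_mem_commProbSetZero {x : ℝ} (hx : x ∈ commProbSetZero) {k : ℕ} (hk : 1 ≤ k) :
    x / k ∈ commProbSetZero := by
  rcases hx with hx | rfl
  · exact Or.inl (div_mem_commProbSet hx hk)
  · rw [zero_div]; exact zero_mem_commProbSetZero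

theorem nonneg_of_mem_commProbSetZero {x : ℝ} (hx : x ∈ commProbSetZero) : 0 ≤ x := by
  rcases hx with hx | rfl
  · exact (pos_of_mem_commProbSet hx).le
  · exact le_rfl

theorem le_one_of_mem_commProbSetZero {x : ℝ} (hx : x ∈ commProbSetZero) : x ≤ 1 := by
  rcases hx with hx | rfl
  · exact le_one_of_mem_commProbSet hx
  · exact zero_le_one

theorem commProbLayer_subset (n : ℕ) : commProbLayer n ⊆ commProbSetZero := by
  intro x hx
  obtain ⟨k, hk, y, hy, rfl⟩ := mem_commProbLayer.1 hx
  exact div_mem_commProbSetZero hy hk.1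

theorem commProbLayer_zero : commProbLayer 0 = commProbSetZero :=
  (commProbLayer_subset 0).antisymm fun x hx =>
    mem_commProbLayer.2 ⟨1, by simp, x, hx, by simp⟩

theorem commProbLayer_succ_subset (n : ℕ) : commProbLayer (n + 1) ⊆ commProbLayer n := by
  intro x hx
  obtain ⟨k, hk, hy⟩ := mem_commProbLayer.1 hx
  exact mem_commProbLayer.2 ⟨k, ⟨hk.1, by omega⟩, hy⟩

theorem zero_mem_commProbLayer (n : ℕ) : (0 : ℝ) ∈ commProbLayer n :=
  mem_commProbLayer.2 ⟨2 ^ n, ⟨Nat.one_le_two_pow, by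
    rw [ArithmeticFunction.cardFactors_apply_prime_pow Nat.prime_two]⟩, 0,
    zero_mem_commProbSetZero, by simp⟩

theorem exists_dvd_cardFactors_eq {k n : ℕ} (hk : 1 ≤ k)
    (h : n ≤ ArithmeticFunction.cardFactors k) :
    ∃ d : ℕ, d ∣ k ∧ 1 ≤ d ∧ ArithmeticFunction.cardFactors d = n := by
  induction n with
  | zero => exact ⟨1, one_dvd _, le_rfl, by simp⟩
  | succ n ih =>
    obtain ⟨d, ⟨e, rfl⟩, hd, hdn⟩ := ih (by omega)
    have he : e ≠ 0 := by rintro rfl; simp at hk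
    rw [ArithmeticFunction.cardFactors_mul (by omega) he] at h
    have he1 : e ≠ 1 := by rintro rfl; simp at h; omega
    refine ⟨d * e.minFac, Nat.mul_dvd_mul_left _ e.minFac_dvd,
      Nat.mul_pos hd e.minFac_pos, ?_⟩
    rw [ArithmeticFunction.cardFactors_mul (by omega) e.minFac_pos.ne', hdn,
      ArithmeticFunction.cardFactors_eq_one_iff_prime.2 (Nat.minFac_prime he1)]

/-- Surplus prime factors are absorbed into the numerator, since `commProbSetZero` is stable under
division by positive integers. -/
theorem mem_commProbLayer_iff_eq {n : ℕ} {x : ℝ} : x ∈ commProbLayer n ↔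
    ∃ k : ℕ, (1 ≤ k ∧ ArithmeticFunction.cardFactors k = n) ∧ ∃ y ∈ commProbSetZero, x = y / k := by
  rw [mem_commProbLayer]
  constructor
  · rintro ⟨k, ⟨hk, hkn⟩, y, hy, rfl⟩
    obtain ⟨d, ⟨e, rfl⟩, hd, hdn⟩ := exists_dvd_cardFactors_eq hk hkn
    have he : e ≠ 0 := by rintro rfl; simp at hk
    refine ⟨d, ⟨hd, hdn⟩, y / e, div_mem_commProbSetZero hy (by omega), ?_⟩
    rw [div_div, mul_comm (e : ℝ)]
    push_cast
    rfl
  · rintro ⟨k, ⟨hk, hkn⟩, hy⟩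
    exact ⟨k, ⟨hk, hkn.ge⟩, hy⟩

theorem two_pow_cardFactors_le {k : ℕ} (hk : 1 ≤ k) : 2 ^ ArithmeticFunction.cardFactors k ≤ k := by
  induction k using induction_on_primes with
  | zero => omega
  | one => simp
  | prime_mul p a hp ih =>
    have ha : a ≠ 0 := by rintro rfl; simp at hk
    rw [ArithmeticFunction.cardFactors_mul hp.ne_zero ha,
      ArithmeticFunction.cardFactors_eq_one_iff_prime.2 hp, pow_add, pow_one]
    exact Nat.mul_le_mul hp.two_le (ih (by omega))

theorem le_of_mem_commProbLayer {n : ℕ} {x : ℝ} (hx : x ∈ commProbLayer n) :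
    x ≤ 1 / 2 ^ n := by
  obtain ⟨k, hk, y, hy, rfl⟩ := mem_commProbLayer_iff_eq.1 hx
  refine div_le_div₀ zero_le_one (le_one_of_mem_commProbSetZero hy) (by positivity) ?_
  rw [← hk.2]
  exact_mod_cast two_pow_cardFactors_le hk.1

theorem eq_zero_of_forall_mem_commProbLayer {x : ℝ} (hx : ∀ n, x ∈ commProbLayer n) : x = 0 := by
  refine le_antisymm ?_ (nonneg_of_mem_commProbSetZero (commProbLayer_subset 0 (hx 0)))
  refine ge_of_tendsto' (f := fun n : ℕ => (1 / 2 : ℝ) ^ n) (x := atTop)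
    (tendsto_pow_atTop_nhds_zero_of_lt_one (by norm_num) (by norm_num)) fun n => ?_
  rw [div_pow, one_pow]
  exact le_of_mem_commProbLayer (hx n)

theorem mem_derivedSet_of_tendsto {A : Set ℝ} {x : ℝ} (s : ℕ → ℝ) (hs : ∀ n, s n ∈ A)
    (hne : ∀ n, s n ≠ x) (hlim : Tendsto s atTop (𝓝 x)) : x ∈ derivedSet A := by
  rw [mem_derivedSet, accPt_principal_iff_clusterPt, ← mem_closure_iff_clusterPt]
  exact mem_closure_of_tendsto hlim (Eventually.of_forall fun n => ⟨hs n, hne n⟩)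

theorem exists_seq_of_mem_derivedSet {A : Set ℝ} {x : ℝ} (hx : x ∈ derivedSet A) {u : Set ℝ}
    (hu : u ∈ 𝓝 x) :
    ∃ s : ℕ → ℝ, (∀ n, s n ∈ A ∧ s n ≠ x ∧ s n ∈ u) ∧ Tendsto s atTop (𝓝 x) := by
  rw [mem_derivedSet, accPt_principal_iff_clusterPt, ← mem_closure_iff_clusterPt,
    mem_closure_iff_seq_limit] at hx
  obtain ⟨s, hs, hlim⟩ := hx
  obtain ⟨N, hN⟩ := eventually_atTop.1 (hlim hu)
  exact ⟨fun n => s (n + N), fun n => ⟨(hs _).1, (hs _).2, hN _ (Nat.le_add_left _ _)⟩,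
    hlim.comp (tendsto_add_atTop_nat N)⟩

/-- For `y > 0`, multiply `y` by a sequence in `S` tending to `1 / p`, which direct products allow;
`0` is the limit of the reciprocals. -/
theorem div_prime_mem_derivedSet {y : ℝ} (hy : y ∈ commProbSetZero) {p : ℕ} (hp : p.Prime) :
    y / p ∈ derivedSet commProbSetZero := by
  rcases hy with hy | rfl
  · obtain ⟨s, hs, hne, hlim⟩ := exists_seq_tendsto_one_div_prime hp
    have hy0 := pos_of_mem_commProbSet hy
    refine mem_derivedSet_of_tendsto (fun n => y * s n)
      (fun n => Or.inl (mul_mem_commProbSet hy (hs n))) (fun n h => hne n ?_) ?_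
    · rw [div_eq_mul_one_div] at h
      exact mul_left_cancel₀ hy0.ne' h
    · rw [div_eq_mul_one_div]
      exact hlim.const_mul y
  · rw [zero_div]
    refine mem_derivedSet_of_tendsto (fun n : ℕ => 1 / ((n + 1 : ℕ) : ℝ))
      (fun n => Or.inl (one_div_mem_commProbSet n.succ_pos)) (fun n => by positivity) ?_
    simpa using tendsto_one_div_add_atTop_nhds_zero_nat (𝕜 := ℝ)

theorem commProbLayer_succ_subset_derivedSet (n : ℕ) :
    commProbLayer (n + 1) ⊆ derivedSet (commProbLayer n) := by
  intro x hx
  obtain ⟨k, ⟨hk, hkn⟩, y, hy, rfl⟩ := mem_commProbLayer_iff_eq.1 hx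
  have hk1 : k ≠ 1 := by rintro rfl; simp at hkn
  obtain ⟨d, hd⟩ := k.minFac_dvd
  have hp := Nat.minFac_prime hk1
  set p := k.minFac
  have hd0 : d ≠ 0 := by rintro rfl; omega
  have hdn : ArithmeticFunction.cardFactors d = n := by
    rw [hd, ArithmeticFunction.cardFactors_mul hp.ne_zero hd0,
      ArithmeticFunction.cardFactors_eq_one_iff_prime.2 hp] at hkn
    omega
  have hd' : (d : ℝ) ≠ 0 := Nat.cast_ne_zero.2 hd0
  have h1 : y / k ∈ (fun z : ℝ => z / d) '' derivedSet commProbSetZero :=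
    ⟨y / p, div_prime_mem_derivedSet hy hp, by
      rw [hd]; push_cast; rw [div_div]⟩
  refine derivedSet_mono _ _ ?_ (Continuous.image_derivedSet (continuous_id.div_const (d : ℝ))
    (fun a b h => (div_left_inj' hd').1 h) h1)
  rintro _ ⟨z, hz, rfl⟩
  exact mem_commProbLayer_iff_eq.2 ⟨d, ⟨by omega, hdn⟩, z, hz, rfl⟩

/-- Near a positive `x` the denominators are bounded, hence constant `c` along the ultrafilter, and
the numerators tend to `q / l`. Since the sequence avoids `x`, `l ≠ 1`, so `c * l` gains a prime
factor. -/
theorem derivedSet_commProbLayer_subset (n : ℕ) :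
    derivedSet (commProbLayer n) ⊆ commProbLayer (n + 1) := by
  intro x hx
  have hx0 : 0 ≤ x := by
    have h := derivedSet_subset_closure _ hx
    exact closure_minimal (fun y hy => nonneg_of_mem_commProbSetZero (commProbLayer_subset n hy))
      isClosed_Ici h
  rcases hx0.eq_or_lt with rfl | hx0
  · exact zero_mem_commProbLayer _
  obtain ⟨s, hs, hlim⟩ := exists_seq_of_mem_derivedSet hx (Ioi_mem_nhds (half_lt_self hx0))
  have hs1 := fun m => mem_commProbLayer.1 (hs m).1
  choose k hk y hy hsy using hs1
  have hk0 : ∀ m, (0 : ℝ) < k m := fun m => Nat.cast_pos.2 (hk m).1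
  have hys : ∀ m, y m = s m * k m := fun m => by rw [hsy m, div_mul_cancel₀ _ (hk0 m).ne']
  have hsx : ∀ m, x / 2 < s m := fun m => (hs m).2.2
  have hyx : ∀ m, x / 2 ≤ y m := fun m => by
    rw [hys]
    have : (1 : ℝ) ≤ k m := Nat.one_le_cast.2 (hk m).1
    nlinarith [hsx m]
  have hyS : ∀ m, y m ∈ commProbSet := fun m => (hy m).resolve_right fun h => by
    have := hyx m
    rw [Set.mem_singleton_iff.1 h] at this
    linarith
  have hkle : ∀ m, k m ∈ Set.Iic ⌊2 / x⌋₊ := fun m => by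
    refine Nat.le_floor ?_
    rw [le_div_iff₀ hx0]
    have h1 := le_one_of_mem_commProbSet (hyS m)
    rw [hys] at h1
    nlinarith [hsx m, hk0 m]
  obtain ⟨c, -, hc⟩ := (hyperfilter ℕ).exists_eventually_eq k (Set.finite_Iic _)
    (Eventually.of_forall hkle)
  obtain ⟨q, hq, l, hl, hlim', -, hone⟩ :=
    exists_limit_of_mem_commProbSet (hyperfilter ℕ) y hyS (half_pos hx0) hyx
  have hc1 : 1 ≤ c ∧ n ≤ ArithmeticFunction.cardFactors c := by
    obtain ⟨m, hm⟩ := hc.exists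
    exact hm ▸ hk m
  have hc0 : (c : ℝ) ≠ 0 := Nat.cast_ne_zero.2 (by omega)
  have heq : q / l = x * c := by
    refine tendsto_nhds_unique hlim' (((hlim.mono_left Nat.hyperfilter_le_atTop).mul_const
      (c : ℝ)).congr' ?_)
    filter_upwards [hc] with m hm
    rw [hys, hm]
  have hxq : x = q / (c * l : ℕ) := by
    push_cast
    rw [mul_comm, ← div_div, heq, mul_div_cancel_right₀ _ hc0]
  have hl1 : l ≠ 1 := by
    intro h1
    obtain ⟨m, hm, hm'⟩ := (hc.and (hone h1)).exists
    refine (hs m).2.1 ?_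
    rw [hsy m, hm, hm', hxq, h1, mul_one]
  refine mem_commProbLayer.2 ⟨c * l, ⟨Nat.mul_pos hc1.1 hl, ?_⟩, q, Or.inl hq, hxq⟩
  rw [ArithmeticFunction.cardFactors_mul (by omega) (by omega)]
  have : ArithmeticFunction.cardFactors l ≠ 0 := fun h => by
    rcases ArithmeticFunction.cardFactors_eq_zero_iff_eq_zero_or_one.1 h with h | h
    · omega
    · exact hl1 h
  omega

theorem derivedSet_commProbLayer (n : ℕ) :
    derivedSet (commProbLayer n) = commProbLayer (n + 1) :=
  (derivedSet_commProbLayer_subset n).antisymm (commProbLayer_succ_subset_derivedSet n)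

theorem isClosed_commProbSetZero : IsClosed commProbSetZero := by
  rw [isClosed_iff_derivedSet_subset, ← commProbLayer_zero, derivedSet_commProbLayer]
  exact commProbLayer_succ_subset 0

theorem iteratedDerivedSet_commProbSetZero (n : ℕ) :
    CantorBendixson.iteratedDerivedSet commProbSetZero (n : Ordinal.{0}) = commProbLayer n := by
  induction n with
  | zero => rw [Nat.cast_zero, CantorBendixson.iteratedDerivedSet_zero, commProbLayer_zero]
  | succ n ih =>
    rw [Nat.cast_succ, CantorBendixson.iteratedDerivedSet_succ, ih, relDerivedSet_apply,
      derivedSet_commProbLayer]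
    -- The relative derived set intersects with the preceding stage, which changes nothing because
    -- the layers decrease.
    exact Set.inter_eq_left.2 (commProbLayer_succ_subset n)

theorem iteratedDerivedSet_omega0_commProbSetZero :
    CantorBendixson.iteratedDerivedSet commProbSetZero (ω : Ordinal.{0}) = {0} := by
  rw [CantorBendixson.iteratedDerivedSet_limit Ordinal.isSuccLimit_omega0]
  ext x
  rw [Set.mem_iInter, Set.mem_singleton_iff]
  constructor
  · refine fun h => eq_zero_of_forall_mem_commProbLayer fun n => ?_
    rw [← iteratedDerivedSet_commProbSetZero]
    exact h ⟨n, Ordinal.natCast_lt_omega0 n⟩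
  · rintro rfl ⟨o, ho⟩
    obtain ⟨n, rfl⟩ := Ordinal.lt_omega0.1 ho
    rw [iteratedDerivedSet_commProbSetZero]
    exact zero_mem_commProbLayer n

/-- Such a sequence would stay strictly below its supremum, whereas
`exists_limit_of_mem_commProbSet` makes some terms at least the limit. -/
theorem not_strictMono_of_mem_commProbSet (s : ℕ → ℝ) (hs : ∀ n, s n ∈ commProbSet) :
    ¬ StrictMono s := by
  intro hmono
  have hlim := tendsto_atTop_ciSup hmono.monotone
    ⟨1, by rintro _ ⟨n, rfl⟩; exact le_one_of_mem_commProbSet (hs n)⟩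
  obtain ⟨q, -, k, -, hlim', hlow, -⟩ := exists_limit_of_mem_commProbSet (hyperfilter ℕ) s hs
    (pos_of_mem_commProbSet (hs 0)) fun n => hmono.monotone n.zero_le
  rw [tendsto_nhds_unique hlim' (hlim.mono_left Nat.hyperfilter_le_atTop)] at hlow
  obtain ⟨n, hn⟩ := hlow.exists
  exact (hmono n.lt_succ_self).not_ge ((hmono.monotone.ge_of_tendsto hlim (n + 1)).trans hn)

instance isWellOrder_commProbSetZero :
    IsWellOrder commProbSetZero (fun a b : commProbSetZero => b < a) where
  wf := by
    rw [wellFounded_iff_isEmpty_descending_chain]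
    refine ⟨fun ⟨f, hf⟩ => ?_⟩
    have hmono : StrictMono f := strictMono_nat_of_lt_succ hf
    -- The shift discards `f 0`, the only term that can be `0`.
    refine not_strictMono_of_mem_commProbSet (fun n => f (n + 1)) (fun n => ?_)
      (fun a b h => hmono (by omega))
    refine (f (n + 1)).2.resolve_right fun h => ?_
    have h1 : (f n : ℝ) < f (n + 1) := hmono n.lt_succ_self
    rw [Set.mem_singleton_iff.1 h] at h1
    exact h1.not_ge (nonneg_of_mem_commProbSetZero (f n).2)
  trichotomous a b h1 h2 := le_antisymm (not_lt.1 h1) (not_lt.1 h2)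

/-- The commuting probabilities are the points of `commProbSetZero` before `0`. -/
def commProbSetRelIso : (fun a b : commProbSet => b < a) ≃r
    Subrel (fun a b : commProbSetZero => b < a)
      (fun x => (⟨0, zero_mem_commProbSetZero⟩ : commProbSetZero) < x) where
  toFun x := ⟨⟨x, Or.inl x.2⟩, pos_of_mem_commProbSet x.2⟩
  invFun x := ⟨x.1.1, x.1.2.resolve_right fun h => ((show (0 : ℝ) < x.1.1 from x.2).ne' h)⟩
  left_inv _ := rfl
  right_inv _ := rfl
  map_rel_iff' := Iff.rfl

end DerivedSets

theorem mainTheorem4 (X : Set ℝ) (hX : X = commProbSet ∪ {0}) :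
    IsClosed X ∧
    (derivedSet X = ⋃ (k : ℕ) (_ : 2 ≤ k), (1 / (k : ℝ)) • X ∧
      derivedSet X = ⋃ (p : ℕ) (_ : p.Prime), (1 / (p : ℝ)) • X) ∧
    (∀ n : ℕ,
      CantorBendixson.iteratedDerivedSet X (n : Ordinal.{0}) =
        ⋃ (k : ℕ) (_ : 1 ≤ k ∧ n ≤ ArithmeticFunction.cardFactors k), (1 / (k : ℝ)) • X ∧
      CantorBendixson.iteratedDerivedSet X (n : Ordinal.{0}) =
        ⋃ (k : ℕ) (_ : 1 ≤ k ∧ ArithmeticFunction.cardFactors k = n), (1 / (k : ℝ)) • X) ∧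
    CantorBendixson.iteratedDerivedSet X (ω : Ordinal.{0}) = {0} ∧
    ∃ _ : IsWellOrder commProbSet (fun a b : commProbSet => b < a),
      Ordinal.type (fun a b : commProbSet => b < a) = (ω : Ordinal.{0}) ^ (ω : Ordinal.{0}) := by
  obtain rfl : X = commProbSetZero := hX
  have hlayer : ∀ n, commProbLayer n =
      ⋃ (k : ℕ) (_ : 1 ≤ k ∧ ArithmeticFunction.cardFactors k = n),
        (1 / (k : ℝ)) • commProbSetZero := by
    intro n
    ext x
    simp only [mem_commProbLayer_iff_eq, Set.mem_iUnion, mem_one_div_smul, exists_prop]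
  have hderived : derivedSet commProbSetZero = commProbLayer 1 := by
    rw [← derivedSet_commProbLayer, commProbLayer_zero]
  refine ⟨isClosed_commProbSetZero, ⟨?_, ?_⟩, fun n => ⟨?_, ?_⟩,
    iteratedDerivedSet_omega0_commProbSetZero, ?_⟩
  · rw [hderived, commProbLayer]
    refine Set.iUnion_congr fun k => Set.iUnion_congr_Prop ?_ fun _ => rfl
    rw [Nat.one_le_iff_ne_zero (n := ArithmeticFunction.cardFactors k), Ne,
      ArithmeticFunction.cardFactors_eq_zero_iff_eq_zero_or_one]
    omega
  · rw [hderived, hlayer]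
    refine Set.iUnion_congr fun k => Set.iUnion_congr_Prop ?_ fun _ => rfl
    rw [ArithmeticFunction.cardFactors_eq_one_iff_prime]
    exact ⟨fun h => h.2, fun h => ⟨h.one_le, h⟩⟩
  · exact iteratedDerivedSet_commProbSetZero n
  · rw [iteratedDerivedSet_commProbSetZero, hlayer]
  · have hwo : IsWellOrder commProbSet (fun a b : commProbSet => b < a) :=
      commProbSetRelIso.toRelEmbedding.isWellOrder
    refine ⟨hwo, ?_⟩
    rw [Ordinal.type_eq.2 ⟨commProbSetRelIso⟩, Ordinal.type_subrel]
    -- The point `1` serves as the element above `0` from which positions are bounded below.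
    refine typein_eq_omega0_opow_omega0 isClosed_commProbSetZero commProbLayer_zero
      commProbLayer_subset (fun n => (derivedSet_commProbLayer n).symm) _
      ⟨1, Or.inl ?_⟩ (zero_lt_one (α := ℝ)) zero_mem_commProbLayer
      fun z hz => Subtype.ext (eq_zero_of_forall_mem_commProbLayer hz)
    simpa using one_div_mem_commProbSet le_rfl
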